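/- Lemma. Let $H$ be a countable group that is not extensionally strongly Ulam stable. Let $E$ be an ergodic equivalence relation on a standard probability space $(X,\mu)$ that orbitally contains $H$. Then $E$ is not strongly Ulam stable. Here the notions are the following. All Hilbert spaces are complex; $\mathcal U(\mathcal H)$ is the group of unitary operators of $\mathcal H$. Groups. A unitary quasirepresentation of $H$ on $\mathcal H$ is a map $\rho: H\to\mathcal U(\mathcal H)$ with $\rho(1)=\mathrm{Id}$; it is a unitary $\delta$-representation if $\lVert\rho(g)\rho(h)-\rho(gh)\rVert<\delta$ for all $g,h\in H$. Put $\lVert\rho_1-\rho_2\rVert=\sup_{g\in H}\lVert\rho_1(g)-\rho_2(g)\rVert$. The group $H$ is extensionally strongly Ulam stable if for every $\varepsilon>0$ there is $\delta>0$ such that for every unitary $\delta$-representation $\rho$ of $H$ on a Hilbert space $\mathcal H$ there are a Hilbert space $\mathcal H'$ containing $\mathcal H$, a unitary quasirepresentation $\rho'$ of $H$ on $\mathcal H'$ whose restriction to $\mathcal H$ is $\rho$, and a unitary representation $\rho_1$ of $H$ on $\mathcal H'$ with $\lVert\rho'-\rho_1\rVert<\varepsilon$. Equivalence relations. An equivalence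 relation $E$ on a standard probability space $(X,\mu)$ is understood to be a Borel subset of $X\times X$, with countable classes, and measure preserving: every Borel injection between Borel subsets of $X$ whose graph lies in $E$ preserves $\mu$. It is ergodic if every measurable union of $E$-classes is null or conull. It orbitally contains $H$ if there is a measure preserving action of $H$ on $(X,\mu)$ that is essentially free (almost every point has trivial stabilizer) and such that for almost every $x$ the orbit $Hx$ lies in the $E$-class of $x$. The set $E$ carries the measure $\mu^E(A)=\int_X\lvert\{y:(x,y)\in A\}\rvert\,d\mu(x)$, and the set ${}_3E$ of triples $(x,y,z)$ with $(x,y),(y,z)\in E$ carries the measure $A\mapsto\int_X\lvert\{(y,z):(x,y,z)\in A\}\rvert\,d\mu(x)$; "almost every" and "$\operatorname{ess\,sup}$" refer to these measures. Representations of $E$. A unitary quasirepresentation of $E$ on a separable Hilbert space $\mathcal H$ is a map $\eta:E\to\mathcal U(\mathcal H)$, Borel for the strong operator topology, with $\eta(x,x)=\mathrm{Id}$ for almost every $x$. It is a unitary representation if $\eta(y,z)\eta(x,y)=\eta(x,z)$ for almost every $(x,y,z)\in{}_3E$, and a unitary $\delta$-representation if $\operatorname{ess\,sup}_{(x,y,z)\in{}_3E}\lVert\eta(y,z)\eta(x,y)-\eta(x,z)\rVert\le\delta$.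 Put $\lVert\eta_1-\eta_2\rVert=\operatorname{ess\,sup}_{(x,y)\in E}\lVert\eta_1(x,y)-\eta_2(x,y)\rVert$. The relation $E$ is strongly Ulam stable if for every $\varepsilon>0$ there is $\delta>0$ such that for every unitary $\delta$-representation $\eta$ of $E$ on a separable Hilbert space $\mathcal H$ there is a unitary representation $\eta_1$ of $E$ on $\mathcal H$ with $\lVert\eta_1-\eta\rVert<\varepsilon$. -/

import Mathlib

open MeasureTheory Filter
open scoped ENNReal

universe u v w z

namespace UlamStability

/-! ### Groups -/

section Groups

variable {G : Type u} [Group G]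

/-- A unitary `δ`-representation of a group: `ρ 1 = Id` and `‖ρ g ρ h - ρ (g h)‖ < δ`
for all `g`, `h`. -/
def IsUnitaryAlmostRep {H : Type v} [NormedAddCommGroup H] [InnerProductSpace ℂ H]
    [CompleteSpace H] (δ : ℝ) (ρ : G → unitary (H →L[ℂ] H)) : Prop :=
  ρ 1 = 1 ∧ ∀ g h : G, ‖((ρ g * ρ h : unitary (H →L[ℂ] H)) : H →L[ℂ] H) - ρ (g * h)‖ < δ

/-- The uniform distance `sup_g ‖ρ₁ g - ρ₂ g‖` of two unitary valued maps. -/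
noncomputable def groupDist {H : Type v} [NormedAddCommGroup H] [InnerProductSpace ℂ H]
    [CompleteSpace H] (ρ₁ ρ₂ : G → unitary (H →L[ℂ] H)) : ℝ≥0∞ :=
  ⨆ g : G, ‖(ρ₁ g : H →L[ℂ] H) - ρ₂ g‖ₑ

variable (G) in
/-- `G` is extensionally strongly Ulam stable: for every `ε > 0` there is `δ > 0` such that every
unitary `δ`-representation `ρ` on a Hilbert space `H` extends (along an isometric embedding
`V : H → H'` of Hilbert spaces) to a unitary quasirepresentation `ρ'` on `H'` which is at
distance less than `ε` from some unitary representation `ρ₁` on `H'`. -/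
def ExtensionallyStronglyUlamStable : Prop :=
  ∀ ε : ℝ, 0 < ε → ∃ δ : ℝ, 0 < δ ∧
    ∀ (H : Type v) [NormedAddCommGroup H] [InnerProductSpace ℂ H] [CompleteSpace H]
      (ρ : G → unitary (H →L[ℂ] H)), IsUnitaryAlmostRep δ ρ →
      ∃ (H' : Type v) (_ : NormedAddCommGroup H') (_ : InnerProductSpace ℂ H')
        (_ : CompleteSpace H') (V : H →ₗᵢ[ℂ] H') (ρ' : G → unitary (H' →L[ℂ] H'))
        (ρ₁ : G →* unitary (H' →L[ℂ] H')),
        ρ' 1 = 1 ∧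
        (∀ (g : G) (ξ : H), (ρ' g : H' →L[ℂ] H') (V ξ) = V ((ρ g : H →L[ℂ] H) ξ)) ∧
        groupDist ρ' ρ₁ < ENNReal.ofReal ε

end Groups

/-! ### Measures on an equivalence relation -/

/-- For a family of sets `F x ⊆ Y`, `x ∈ X`, the outer measure
`A ↦ ∫ |{y ∈ F x | (x, y) ∈ A}| dμ(x)` on `X × Y`. The integral is an upper one (an infimum over
measurable majorants), so that it makes sense for every set `A`; where the integrand is
measurable it is the usual integral, see `fiberMeasure_apply`. -/
noncomputable def fiberMeasure {X : Type u} {Y : Type v} [MeasurableSpace X] (μ : Measure X)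
    (F : X → Set Y) : OuterMeasure (X × Y) where
  measureOf A := ⨅ (g : X → ℝ≥0∞) (_ : Measurable g)
    (_ : ∀ x, (({y | y ∈ F x ∧ (x, y) ∈ A}.encard : ℕ∞) : ℝ≥0∞) ≤ g x), ∫⁻ x, g x ∂μ
  empty := by
    refine le_antisymm ?_ zero_le
    refine iInf_le_of_le (fun _ => 0) (iInf_le_of_le measurable_const (iInf_le_of_le ?_ ?_)) <;>
      simp
  mono {A B} hAB := by
    refine le_iInf fun g => le_iInf fun hg => le_iInf fun h => ?_
    refine iInf_le_of_le g (iInf_le_of_le hg (iInf_le_of_le (fun x => le_trans ?_ (h x)) le_rfl))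
    have hsub : {y | y ∈ F x ∧ (x, y) ∈ A} ⊆ {y | y ∈ F x ∧ (x, y) ∈ B} :=
      fun y hy => ⟨hy.1, hAB hy.2⟩
    exact_mod_cast Set.encard_le_encard hsub
  iUnion_nat s _ := by
    refine ENNReal.le_of_forall_pos_le_add fun ε hε hfin => ?_
    obtain ⟨ε', hε', hsum⟩ := ENNReal.exists_pos_sum_of_countable
      (ENNReal.coe_pos.2 hε).ne' ℕ
    have key : ∀ i, ∃ g : X → ℝ≥0∞, Measurable g ∧
        (∀ x, (({y | y ∈ F x ∧ (x, y) ∈ s i}.encard : ℕ∞) : ℝ≥0∞) ≤ g x) ∧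
        ∫⁻ x, g x ∂μ ≤ (⨅ (g : X → ℝ≥0∞) (_ : Measurable g)
          (_ : ∀ x, (({y | y ∈ F x ∧ (x, y) ∈ s i}.encard : ℕ∞) : ℝ≥0∞) ≤ g x),
          ∫⁻ x, g x ∂μ) + ε' i := by
      intro i
      have hlt := ENNReal.lt_add_right (ne_top_of_le_ne_top hfin.ne (ENNReal.le_tsum i))
        (ENNReal.coe_pos.2 (hε' i)).ne'

      obtain ⟨g, h⟩ := iInf_lt_iff.1 hlt
      obtain ⟨hg, h⟩ := iInf_lt_iff.1 h
      obtain ⟨hle, h⟩ := iInf_lt_iff.1 h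
      exact ⟨g, hg, hle, h.le⟩
    choose g hg hle hint using key
    refine iInf_le_of_le (fun x => ∑' i, g i x)
      (iInf_le_of_le (Measurable.tsum hg) (iInf_le_of_le (fun x => ?_) ?_))
    · have hU : {y | y ∈ F x ∧ (x, y) ∈ ⋃ i, s i} = ⋃ i, {y | y ∈ F x ∧ (x, y) ∈ s i} := by
        ext y; simp
      rw [hU, ← ENNReal.tsum_set_one]
      refine (ENNReal.tsum_iUnion_le_tsum (fun _ => 1) _).trans (ENNReal.tsum_le_tsum fun i => ?_)
      rw [ENNReal.tsum_set_one]
      exact hle i x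
    · rw [lintegral_tsum fun i => (hg i).aemeasurable]
      refine (ENNReal.tsum_le_tsum hint).trans ?_
      rw [ENNReal.tsum_add]
      gcongr

theorem fiberMeasure_apply {X : Type u} {Y : Type v} [MeasurableSpace X] (μ : Measure X)
    (F : X → Set Y) (A : Set (X × Y))
    (hA : Measurable fun x => (({y | y ∈ F x ∧ (x, y) ∈ A}.encard : ℕ∞) : ℝ≥0∞)) :
    fiberMeasure μ F A = ∫⁻ x, (({y | y ∈ F x ∧ (x, y) ∈ A}.encard : ℕ∞) : ℝ≥0∞) ∂μ := by
  refine le_antisymm (iInf_le_of_le _ (iInf_le_of_le hA (iInf_le_of_le (fun _ => le_rfl) le_rfl)))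
    (le_iInf fun g => le_iInf fun _ => le_iInf fun h => lintegral_mono h)

theorem ae_fiberMeasure_iff {X : Type u} {Y : Type v} [MeasurableSpace X] (μ : Measure X)
    (F : X → Set Y) (P : X × Y → Prop) :
    (∀ᵐ p ∂(fiberMeasure μ F), P p) ↔ ∀ᵐ x ∂μ, ∀ y ∈ F x, P (x, y) := by
  have hval : ∀ A : Set (X × Y), fiberMeasure μ F A = ⨅ (g : X → ℝ≥0∞) (_ : Measurable g)
    (_ : ∀ x, (({y | y ∈ F x ∧ (x, y) ∈ A}.encard : ℕ∞) : ℝ≥0∞) ≤ g x), ∫⁻ x, g x ∂μ :=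
    fun _ => rfl
  rw [ae_iff, ae_iff]
  constructor
  · intro h
    refine le_antisymm (le_of_forall_gt fun c hc => ?_) zero_le
    rw [← h, hval] at hc
    obtain ⟨g, hc⟩ := iInf_lt_iff.1 hc
    obtain ⟨hg, hc⟩ := iInf_lt_iff.1 hc
    obtain ⟨hle, hc⟩ := iInf_lt_iff.1 hc
    refine lt_of_le_of_lt (le_trans (measure_mono (t := {x | 1 ≤ g x}) ?_) ?_) hc
    · intro x hx
      simp only [Set.mem_ofPred_eq, not_forall] at hx
      obtain ⟨y, hy, hP⟩ := hx
      refine le_trans ?_ (hle x)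
      have hne : {y | y ∈ F x ∧ (x, y) ∈ {p | ¬ P p}}.Nonempty := ⟨y, hy, hP⟩
      exact_mod_cast Set.one_le_encard_iff_nonempty.2 hne
    · simpa using mul_meas_ge_le_lintegral₀ hg.aemeasurable 1 (μ := μ)
  · intro h
    refine le_antisymm ?_ zero_le
    rw [hval]
    set N := toMeasurable μ {x | ¬ ∀ y ∈ F x, P (x, y)} with hN
    have hNm : MeasurableSet N := measurableSet_toMeasurable _ _
    refine iInf_le_of_le (N.indicator fun _ => ⊤) (iInf_le_of_le
      (measurable_const.indicator hNm) (iInf_le_of_le (fun x => ?_) ?_))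
    · by_cases hx : x ∈ N
      · simp [hx]
      · have hx' : ∀ y ∈ F x, P (x, y) := by
          by_contra hcon
          exact hx (subset_toMeasurable μ _ hcon)
        have hemp : {y | y ∈ F x ∧ (x, y) ∈ {p | ¬ P p}} = ∅ := by
          ext y
          simpa using hx' y
        rw [hemp]
        simp
    · rw [lintegral_indicator hNm, lintegral_const, Measure.restrict_apply_univ, hN,
        measure_toMeasurable, h, mul_zero]

section Relations

variable {X : Type u} [MeasurableSpace X]

/-- `E` is a Borel equivalence relation with countable classes which preserves `μ`: every partial
Borel injection (the restriction of `f` to the Borel set `A`) whose graph lies in `E` is measure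
preserving. -/
structure IsCountableMPEquivRel (μ : Measure X) (E : Setoid X) : Prop where
  measurableSet : MeasurableSet {p : X × X | E p.1 p.2}
  countable_class : ∀ x, {y | E x y}.Countable
  measure_image : ∀ (A : Set X) (f : X → X), MeasurableSet A → Measurable f → Set.InjOn f A →
    (∀ x ∈ A, E x (f x)) → μ (f '' A) = μ A

/-- Every measurable union of `E`-classes is null or conull. -/
def IsErgodicRel (μ : Measure X) (E : Setoid X) : Prop :=
  ∀ A : Set X, MeasurableSet A → (∀ x y, E x y → x ∈ A → y ∈ A) → μ A = 0 ∨ μ Aᶜ = 0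

/-- `E` orbitally contains the group `G`: there is an essentially free measure preserving action
of `G` on `(X, μ)` such that the orbit of almost every point lies in its `E`-class. -/
def OrbitallyContains (μ : Measure X) (E : Setoid X) (G : Type v) [Group G] : Prop :=
  ∃ _ : MulAction G X,
    (∀ g : G, MeasurePreserving (fun x : X => g • x) μ μ) ∧
    (∀ᵐ x ∂μ, ∀ g : G, g • x = x → g = 1) ∧
    (∀ᵐ x ∂μ, ∀ g : G, E x (g • x))

/-- The measure `A ↦ ∫ |{y | (x, y) ∈ A ∩ E}| dμ(x)` on the pairs in `E`. -/
noncomputable def pairMeasure (μ : Measure X) (E : Setoid X) : OuterMeasure (X × X) :=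
  fiberMeasure μ fun x => {y | E x y}

/-- The measure `A ↦ ∫ |{(y, z) | (x, y, z) ∈ A, (x, y) ∈ E, (y, z) ∈ E}| dμ(x)` on triples. -/
noncomputable def tripleMeasure (μ : Measure X) (E : Setoid X) : OuterMeasure (X × X × X) :=
  fiberMeasure μ fun x => {q : X × X | E x q.1 ∧ E q.1 q.2}

variable {H : Type v} [NormedAddCommGroup H] [InnerProductSpace ℂ H] [CompleteSpace H]

/-- A unitary quasirepresentation of `E` on `H`: a map from `E` to the unitary operators of `H`,
Borel for the strong operator topology, with `η (x, x) = Id` almost everywhere. Only the values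
`η x y` at pairs `(x, y) ∈ E` matter. -/
structure IsUnitaryQuasiRep (μ : Measure X) (E : Setoid X) (η : X → X → unitary (H →L[ℂ] H)) :
    Prop where
  stronglyMeasurable : ∀ ξ : H, StronglyMeasurable
    fun p : {p : X × X // E p.1 p.2} => (η p.1.1 p.1.2 : H →L[ℂ] H) ξ
  map_self : ∀ᵐ x ∂μ, η x x = 1

/-- A unitary representation of `E`: moreover `η (y, z) η (x, y) = η (x, z)` almost everywhere. -/
structure IsUnitaryRep (μ : Measure X) (E : Setoid X) (η : X → X → unitary (H →L[ℂ] H)) :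
    Prop extends IsUnitaryQuasiRep μ E η where
  map_mul : ∀ᵐ t ∂(tripleMeasure μ E), η t.2.1 t.2.2 * η t.1 t.2.1 = η t.1 t.2.2

/-- The defect: the essential supremum over `(x, y, z)` with `(x, y), (y, z) ∈ E` of
`‖η (y, z) η (x, y) - η (x, z)‖`. -/
noncomputable def defect (μ : Measure X) (E : Setoid X) (η : X → X → unitary (H →L[ℂ] H)) :
    ℝ≥0∞ :=
  limsup (fun t : X × X × X =>
    ‖((η t.2.1 t.2.2 * η t.1 t.2.1 : unitary (H →L[ℂ] H)) : H →L[ℂ] H) - η t.1 t.2.2‖ₑ)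
    (ae (tripleMeasure μ E))

/-- The distance: the essential supremum over `(x, y) ∈ E` of `‖η₁ (x, y) - η₂ (x, y)‖`. -/
noncomputable def relDist (μ : Measure X) (E : Setoid X) (η₁ η₂ : X → X → unitary (H →L[ℂ] H)) :
    ℝ≥0∞ :=
  limsup (fun p : X × X => ‖(η₁ p.1 p.2 : H →L[ℂ] H) - η₂ p.1 p.2‖ₑ) (ae (pairMeasure μ E))

/-- `E` is strongly Ulam stable: for every `ε > 0` there is `δ > 0` such that every unitary
`δ`-representation of `E` on a separable Hilbert space is at distance less than `ε` from a unitary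
representation of `E` on the same space. -/
def StronglyUlamStable (μ : Measure X) (E : Setoid X) : Prop :=
  ∀ ε : ℝ, 0 < ε → ∃ δ : ℝ, 0 < δ ∧
    ∀ (H : Type w) [NormedAddCommGroup H] [InnerProductSpace ℂ H] [CompleteSpace H]
      [TopologicalSpace.SeparableSpace H] (η : X → X → unitary (H →L[ℂ] H)),
      IsUnitaryQuasiRep μ E η → defect μ E η ≤ ENNReal.ofReal δ →
      ∃ η₁ : X → X → unitary (H →L[ℂ] H),
        IsUnitaryRep μ E η₁ ∧ relDist μ E η₁ η < ENNReal.ofReal ε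

end Relations

end UlamStability

universe v'

namespace UlamStability

open Set Topology

/-! The argument is by contraposition: strong Ulam stability of `E` passes down to extensional
strong Ulam stability of every countable group `Γ` acting essentially freely inside its classes
(`extensionallyStronglyUlamStable_of_orbitallyContains`). Let `π` be a δ-representation of `Γ` on a
separable space `H`.

Induction. A class of `E` splits into `Γ`-orbits. For each `x`, list injectively all pairs of an
orbit in its class and a natural number. The set of pairs depends only on the class, so two points
of a class determine a permutation of ℕ, and these permutations compose exactly. The second
component makes the number of orbits in a class irrelevant. Each index also carries a base point in
its orbit, given by Borel maps `f n` enumerating the class. The operator `η(x, y)` on ℓ²(ℕ, H)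
permutes coordinates and applies to each one `π(g)`, where `g` is the element, unique by freeness,
that moves one base point to the other. Hence `η` has defect at most δ
(`norm_inducedCocycle_mul_sub_le`). Index 0 has base point `x` itself, so `η(x, gx)` acts as `π(g)`
on coordinate 0 (`inducedCocycle_single_zero`).

Descent. Stability yields a representation `η₁` near `η`. On L²(X, ℓ²(ℕ, H)) put (A_g F)(x) =
η(g⁻¹x, x) F(g⁻¹x), and likewise with `η₁`. The second family is a representation of `Γ` uniformly
near the first, and on the constant functions with values in coordinate 0 the first family is `π`
(`hasNearbyExtension_of_cocycle`). The enlarged space is the reason why the group property obtained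
is the extensional one.

Two supports remain. Arbitrary Hilbert spaces are cut into separable pieces invariant under the free
group on `Γ`, and the extensions are summed (`hasNearbyExtension_of_forall_separable`). The maps `f
n` come from an almost everywhere version of the Lusin–Novikov theorem (`exists_nat_injOn_cover`),
which also shows that null sets can be avoided on whole classes
(`IsCountableMPEquivRel.ae_forall_class`). -/

/-! ### Borel maps with countable fibres -/

/-- Boxes in Baire space are compact. -/
theorem isCompact_box (n : ℕ → ℕ) : IsCompact {β : ℕ → ℕ | ∀ i, β i ≤ n i} := by
  convert isCompact_univ_pi (X := fun _ : ℕ => ℕ) (s := fun i => Set.Iic (n i))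
    (fun i => (Set.finite_Iic (n i)).isCompact) using 1
  ext β
  simp [Pi.le_def]

/-- If a compact box in Baire space lies in an open set, so does one of the cylinders around it. -/
theorem exists_cylinder_subset_of_box_subset {V : Set (ℕ → ℕ)} (hV : IsOpen V) (n : ℕ → ℕ)
    (h : {β : ℕ → ℕ | ∀ i, β i ≤ n i} ⊆ V) : ∃ k, {β : ℕ → ℕ | ∀ i < k, β i ≤ n i} ⊆ V := by
  by_contra! hcon
  simp only [Set.not_subset] at hcon
  choose β hβ hβV using hcon
  obtain ⟨γ, hγ, φ, hφ, hlim⟩ :=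
    (isCompact_box n).tendsto_subseq (x := fun k i => min (β k i) (n i)) (fun k i => min_le_right _ _)
  have hlim' : Tendsto (β ∘ φ) atTop (𝓝 γ) := by
    rw [tendsto_pi_nhds] at hlim ⊢
    intro i
    refine (hlim i).congr' ?_
    filter_upwards [eventually_gt_atTop i] with k hk
    exact min_eq_left (hβ _ _ (hk.trans_le (hφ.id_le k)))
  obtain ⟨k, hk⟩ := (hlim'.eventually (hV.mem_nhds (h hγ))).exists
  exact hβV _ hk

/-- Choquet's capacitability argument: bound the coordinates of Baire space one at a time, keeping
the measure of the image above `c`. The bounds cut out a compact box, and its image is the required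
set. -/
theorem exists_isCompact_subset_range_of_lt {X : Type*} [TopologicalSpace X] [PolishSpace X]
    [MeasurableSpace X] [BorelSpace X] (μ : Measure X) [IsFiniteMeasure μ] {f : (ℕ → ℕ) → X}
    (hf : Continuous f) {c : ℝ≥0∞} (hc : c < μ (range f)) :
    ∃ K ⊆ range f, IsCompact K ∧ c ≤ μ K := by
  -- Continuity from below holds for arbitrary increasing sets, so the images need not be known to
  -- be measurable.
  have step : ∀ (k : ℕ) (S : Set (ℕ → ℕ)), c < μ (f '' S) →
      ∃ n, c < μ (f '' (S ∩ {β | β k ≤ n})) := by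
    intro k S hS
    have hmono : Monotone fun n : ℕ => f '' (S ∩ {β | β k ≤ n}) := fun a b hab =>
      image_mono (inter_subset_inter_right _ fun β (hβ : β k ≤ a) => le_trans hβ hab)
    have hU : ⋃ n : ℕ, f '' (S ∩ {β | β k ≤ n}) = f '' S := by
      rw [← image_iUnion, ← inter_iUnion]
      congr 1
      refine inter_eq_left.2 fun β _ => mem_iUnion.2 ⟨β k, le_refl (β k)⟩
    rw [← hU, hmono.measure_iUnion] at hS
    exact lt_iSup_iff.1 hS
  choose! N hN using step
  let S : ℕ → Set (ℕ → ℕ) := fun k => Nat.rec univ (fun k S => S ∩ {β | β k ≤ N k S}) k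
  have hS : ∀ k, c < μ (f '' S k) := by
    intro k
    induction k with
    | zero => simpa [S] using hc
    | succ k ih => exact hN k _ ih
  let n : ℕ → ℕ := fun k => N k (S k)
  have hSn : ∀ k, S k = {β | ∀ i < k, β i ≤ n i} := by
    intro k
    induction k with
    | zero => simp [S]
    | succ k ih =>
      change S k ∩ {β | β k ≤ n k} = _
      rw [ih]
      ext β
      simp only [mem_inter_iff, mem_ofPred_eq, Nat.lt_succ_iff]
      constructor
      · rintro ⟨h1, h2⟩ i hi
        rcases hi.lt_or_eq with h | rfl
        exacts [h1 i h, h2]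
      · exact fun h => ⟨fun i hi => h i hi.le, h k le_rfl⟩
  refine ⟨f '' {β | ∀ i, β i ≤ n i}, image_subset_range _ _, (isCompact_box n).image hf, ?_⟩
  -- Measures of the cylinder images need not converge to that of the box image. Outer regularity
  -- replaces this: an open set around the box image contains the image of some cylinder.
  rw [Set.measure_eq_iInf_isOpen]
  refine le_iInf fun U => le_iInf fun hKU => le_iInf fun hU => ?_
  obtain ⟨k, hk⟩ := exists_cylinder_subset_of_box_subset (hU.preimage hf) n
    (image_subset_iff.1 hKU)
  refine (hS k).le.trans (measure_mono ?_)
  rw [hSn k]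
  exact image_subset_iff.2 hk

/-- Analytic sets are measurable for every finite Borel measure. -/
theorem nullMeasurableSet_of_analyticSet {X : Type*} [TopologicalSpace X] [PolishSpace X]
    [MeasurableSpace X] [BorelSpace X] (μ : Measure X) [IsFiniteMeasure μ] {A : Set X}
    (hA : AnalyticSet A) : NullMeasurableSet A μ := by
  rw [AnalyticSet] at hA
  rcases hA with rfl | ⟨f, hf, rfl⟩
  · exact MeasurableSet.empty.nullMeasurableSet
  rcases eq_or_ne (μ (range f)) 0 with h0 | h0
  · exact NullMeasurableSet.of_null h0
  obtain ⟨u, -, hu, hlim⟩ := exists_seq_strictMono_tendsto' (pos_iff_ne_zero.2 h0)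
  choose K hKA hKc hK using fun n => exists_isCompact_subset_range_of_lt μ hf (hu n).2
  have hm : MeasurableSet (⋃ n, K n) := MeasurableSet.iUnion fun n => (hKc n).measurableSet
  have hle : μ (range f) ≤ μ (⋃ n, K n) :=
    le_of_tendsto' hlim fun n => (hK n).trans (measure_mono (subset_iUnion K n))
  exact hm.nullMeasurableSet.congr
    (ae_eq_of_subset_of_measure_ge (iUnion_subset hKA) hle hm.nullMeasurableSet
      (measure_ne_top _ _))

/-- A nonempty countable closed set in a Polish space has an isolated point. -/
theorem exists_isolated_of_countable_isClosed {Z : Type*} [TopologicalSpace Z] [PolishSpace Z]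
    {C : Set Z} (hC : IsClosed C) (hcount : C.Countable) (hne : C.Nonempty) :
    ∃ z, ∃ U, IsOpen U ∧ U ∩ C = {z} := by
  have := hC.polishSpace
  have := hcount.to_subtype
  have := hne.to_subtype
  let _ := TopologicalSpace.upgradeIsCompletelyMetrizable C
  obtain ⟨c, hc⟩ := nonempty_interior_of_iUnion_of_closed (X := C) (f := fun c : C => {c})
    (fun c => isClosed_singleton) (iUnion_of_singleton C)
  have hopen : IsOpen ({c} : Set C) := by
    have : interior ({c} : Set C) = {c} :=
      (subset_singleton_iff_eq.1 interior_subset).resolve_left hc.ne_empty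
    exact interior_eq_iff_isOpen.1 this
  obtain ⟨U, hU, hUc⟩ := isOpen_induced_iff.1 hopen
  refine ⟨c, U, hU, ?_⟩
  ext z
  constructor
  · rintro ⟨hzU, hzC⟩
    have : (⟨z, hzC⟩ : C) ∈ Subtype.val ⁻¹' U := hzU
    rw [hUc] at this
    exact congrArg Subtype.val (mem_singleton_iff.1 this)
  · rintro rfl
    refine ⟨?_, c.2⟩
    have : c ∈ Subtype.val ⁻¹' U := by rw [hUc]; rfl
    exact this

/-- A Borel set `W` with closed fibres over `X` whose complement is a countable union of Borel
sets on which `f` is injective. -/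
structure IsFiberwiseClosedCore {X Z : Type*} [TopologicalSpace Z] [MeasurableSpace Z]
    (f : Z → X) (W : Set Z) : Prop where
  measurableSet : MeasurableSet W
  isClosed_fiber : ∀ x, IsClosed (W ∩ f ⁻¹' {x})
  cover : ∃ 𝒜 : Set (Set Z), 𝒜.Countable ∧ (∀ A ∈ 𝒜, MeasurableSet A ∧ InjOn f A) ∧ Wᶜ ⊆ ⋃₀ 𝒜

theorem IsFiberwiseClosedCore.iInter {X Z ι : Type*} [TopologicalSpace Z] [MeasurableSpace Z]
    [Countable ι] [Nonempty ι] {f : Z → X} {W : ι → Set Z}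
    (hW : ∀ i, IsFiberwiseClosedCore f (W i)) :
    IsFiberwiseClosedCore f (⋂ i, W i) := by
  choose 𝒜 hc hA hcov using fun i => (hW i).cover
  refine ⟨MeasurableSet.iInter fun i => (hW i).measurableSet, fun x => ?_,
    ⋃ i, 𝒜 i, countable_iUnion hc, ?_, ?_⟩
  · rw [iInter_inter]
    exact isClosed_iInter fun i => (hW i).isClosed_fiber x
  · intro A hAm
    obtain ⟨i, hi⟩ := mem_iUnion.1 hAm
    exact hA i A hi
  · rw [compl_iInter, sUnion_iUnion]
    exact iUnion_mono hcov

/-- There is a core which minimizes the measures of the projections of countably many sets. -/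
theorem exists_isFiberwiseClosedCore_minimal {X Z ι : Type*} [TopologicalSpace Z]
    [MeasurableSpace Z] [TopologicalSpace X] [T1Space X] [MeasurableSpace X]
    (μ : Measure X) {f : Z → X} (hf : Continuous f) [Countable ι] [Nonempty ι] (U : ι → Set Z) :
    ∃ W, IsFiberwiseClosedCore f W ∧ ∀ W', IsFiberwiseClosedCore f W' → ∀ i,
      μ (f '' (U i ∩ W)) ≤ μ (f '' (U i ∩ W')) := by
  have huniv : IsFiberwiseClosedCore f univ :=
    ⟨MeasurableSet.univ, fun x => by simpa using isClosed_singleton.preimage hf,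
      ∅, countable_empty, by simp, by simp⟩
  have key : ∀ i, ∃ V : ℕ → Set Z, (∀ n, IsFiberwiseClosedCore f (V n)) ∧
      ∀ W', IsFiberwiseClosedCore f W' → ∀ b, μ (f '' (U i ∩ W')) < b →
        ∃ n, μ (f '' (U i ∩ V n)) < b := by
    intro i
    obtain ⟨u, -, hu, hmem⟩ := exists_seq_tendsto_sInf
      (S := (fun W => μ (f '' (U i ∩ W))) '' {W | IsFiberwiseClosedCore f W})
      (Set.Nonempty.image _ ⟨univ, huniv⟩) (OrderBot.bddBelow _)
    choose V hV hVu using hmem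
    refine ⟨V, hV, fun W' hW' b hb => ?_⟩
    have hlt : sInf ((fun W => μ (f '' (U i ∩ W))) '' {W | IsFiberwiseClosedCore f W}) < b :=
      lt_of_le_of_lt (sInf_le (mem_image_of_mem _ hW')) hb
    obtain ⟨n, hn⟩ := (hu.eventually (gt_mem_nhds hlt)).exists
    exact ⟨n, by rw [← hVu n] at hn; exact hn⟩
  choose V hV hVmin using key
  refine ⟨⋂ p : ι × ℕ, V p.1 p.2, IsFiberwiseClosedCore.iInter fun p => hV p.1 p.2,
    fun W' hW' i => le_of_forall_gt fun b hb => ?_⟩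
  obtain ⟨n, hn⟩ := hVmin i W' hW' b hb
  exact lt_of_le_of_lt (measure_mono (image_mono
    (inter_subset_inter_right _ (iInter_subset _ (i, n))))) hn

/-- One Cantor–Bendixson step applied to a minimal core `W`. Removing the parts of `W` where a basic
open set meets the fibre in a single point leaves a core, so by minimality the projections lose only
null sets. Hence almost no fibre of `W` has an isolated point; being closed and countable, almost
every fibre is empty. -/
theorem exists_countable_injOn_cover_of_continuous {X Z : Type*} [TopologicalSpace Z]
    [PolishSpace Z] [MeasurableSpace Z] [BorelSpace Z] [TopologicalSpace X] [PolishSpace X]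
    [MeasurableSpace X] [BorelSpace X] (μ : Measure X) [IsFiniteMeasure μ] {f : Z → X}
    (hf : Continuous f) (hcount : ∀ x, (f ⁻¹' {x}).Countable) :
    ∃ 𝒜 : Set (Set Z), 𝒜.Countable ∧ (∀ A ∈ 𝒜, MeasurableSet A ∧ InjOn f A) ∧
      ∀ᵐ x ∂μ, f ⁻¹' {x} ⊆ ⋃₀ 𝒜 := by
  rcases isEmpty_or_nonempty Z with hZ | hZ
  · exact ⟨∅, countable_empty, by simp, ae_of_all _ fun x z _ => (hZ.false z).elim⟩
  let B := TopologicalSpace.countableBasis Z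
  have hB : TopologicalSpace.IsTopologicalBasis B := TopologicalSpace.isBasis_countableBasis Z
  have : Countable B := (TopologicalSpace.countable_countableBasis Z).to_subtype
  have : Nonempty B := by
    obtain ⟨z⟩ := hZ
    obtain ⟨V, hV, -⟩ := hB.exists_subset_of_mem_open (mem_univ z) isOpen_univ
    exact ⟨⟨V, hV⟩⟩
  have hBo : ∀ U : B, IsOpen (U : Set Z) := fun U => hB.isOpen U.2
  obtain ⟨W, hW, hmin⟩ := exists_isFiberwiseClosedCore_minimal μ hf (fun U : B => (U : Set Z))
  have hnull : ∀ S : Set Z, MeasurableSet S → NullMeasurableSet (f '' S) μ := fun S hS =>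
    nullMeasurableSet_of_analyticSet μ (hS.analyticSet_image hf.measurable)
  -- The points with exactly one preimage in `U ∩ W`: two distinct preimages would be separated by
  -- disjoint basic open sets.
  let I : B → Set X := fun U => f '' (U ∩ W) \ ⋃ p : {p : B × B // Disjoint (p.1 : Set Z) p.2},
    f '' (U ∩ W ∩ p.1.1) ∩ f '' (U ∩ W ∩ p.1.2)
  have hI : ∀ U, NullMeasurableSet (I U) μ := by
    intro U
    have h1 : MeasurableSet ((U : Set Z) ∩ W) := (hBo U).measurableSet.inter hW.measurableSet
    refine (hnull _ h1).diff (NullMeasurableSet.iUnion fun p => ?_)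
    exact (hnull _ (h1.inter (hBo _).measurableSet)).inter
      (hnull _ (h1.inter (hBo _).measurableSet))
  have hI_inj : ∀ U, ∀ x ∈ I U, ∀ z ∈ (U : Set Z) ∩ W, ∀ z' ∈ (U : Set Z) ∩ W,
      f z = x → f z' = x → z = z' := by
    intro U x hx z hz z' hz' hfz hfz'
    by_contra hne
    obtain ⟨S, T, hS, hT, hzS, hzT, hd⟩ := t2_separation hne
    obtain ⟨S', hS'B, hzS', hS'⟩ := hB.exists_subset_of_mem_open hzS hS
    obtain ⟨T', hT'B, hzT', hT'⟩ := hB.exists_subset_of_mem_open hzT hT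
    refine hx.2 (mem_iUnion.2 ⟨⟨(⟨S', hS'B⟩, ⟨T', hT'B⟩), hd.mono hS' hT'⟩, ?_⟩)
    exact ⟨⟨z, ⟨hz, hzS'⟩, hfz⟩, ⟨z', ⟨hz', hzT'⟩, hfz'⟩⟩
  choose J hJI hJm hJ using fun U => (hI U).exists_measurable_subset_ae_eq
  let P : B → Set Z := fun U => U ∩ W ∩ f ⁻¹' J U
  have hPm : ∀ U, MeasurableSet (P U) := fun U =>
    ((hBo U).measurableSet.inter hW.measurableSet).inter (hf.measurable (hJm U))
  have hPinj : ∀ U, InjOn f (P U) := fun U z hz z' hz' h =>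
    hI_inj U (f z) (hJI U hz.2) z hz.1 z' hz'.1 rfl h.symm
  obtain ⟨𝒜, h𝒜c, h𝒜, h𝒜cov⟩ := hW.cover
  have hW' : IsFiberwiseClosedCore f (W \ ⋃ U, P U) := by
    refine ⟨hW.measurableSet.diff (MeasurableSet.iUnion hPm), fun x => ?_,
      𝒜 ∪ range P, h𝒜c.union (countable_range P), ?_, ?_⟩
    -- Over a fixed `x`, deleting `P U` deletes the whole open set `U` or nothing, so the fibres
    -- stay closed.
    · have : (W \ ⋃ U, P U) ∩ f ⁻¹' {x} =
          (W ∩ f ⁻¹' {x}) ∩ ⋂ U : {U : B // x ∈ J U}, ((U : B) : Set Z)ᶜ := by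
        ext z
        simp only [mem_inter_iff, Set.mem_sdiff, mem_iUnion, not_exists, mem_preimage,
          mem_singleton_iff, mem_iInter, mem_compl_iff, P, Subtype.forall]
        constructor
        · rintro ⟨⟨hzW, hz⟩, rfl⟩
          exact ⟨⟨hzW, rfl⟩, fun U hU hJ hzU => hz U hU ⟨⟨hzU, hzW⟩, hJ⟩⟩
        · rintro ⟨⟨hzW, rfl⟩, hz⟩
          exact ⟨⟨hzW, fun U hU h => hz U hU h.2 h.1.1⟩, rfl⟩
      rw [this]
      exact (hW.isClosed_fiber x).inter (isClosed_iInter fun U => (hBo _).isClosed_compl)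
    · rintro A (hA | ⟨U, rfl⟩)
      exacts [h𝒜 A hA, ⟨hPm U, hPinj U⟩]
    · intro z hz
      by_cases hzW : z ∈ W
      · have : z ∈ ⋃ U, P U := by
          by_contra h
          exact hz ⟨hzW, h⟩
        obtain ⟨U, hU⟩ := mem_iUnion.1 this
        exact ⟨P U, Or.inr ⟨U, rfl⟩, hU⟩
      · obtain ⟨A, hA, hzA⟩ := h𝒜cov hzW
        exact ⟨A, Or.inl hA, hzA⟩
  have hae : ∀ U : B, f '' (U ∩ (W \ ⋃ U, P U)) =ᵐ[μ] f '' (U ∩ W) := fun U =>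
    ae_eq_of_subset_of_measure_ge (image_mono (inter_subset_inter_right _ sdiff_subset))
      (hmin _ hW' U) (hnull _ ((hBo U).measurableSet.inter hW'.measurableSet)) (measure_ne_top _ _)
  refine ⟨𝒜, h𝒜c, h𝒜, ?_⟩
  filter_upwards [ae_all_iff.2 hJ, ae_all_iff.2 hae] with x hxJ hx
  have hempty : W ∩ f ⁻¹' {x} = ∅ := by
    by_contra hne
    obtain ⟨z, S, hS, hSz⟩ := exists_isolated_of_countable_isClosed (hW.isClosed_fiber x)
      ((hcount x).mono inter_subset_right) (nonempty_iff_ne_empty.2 hne)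
    have hzS : z ∈ S ∩ (W ∩ f ⁻¹' {x}) := by rw [hSz]; rfl
    obtain ⟨U, hUB, hzU, hUS⟩ := hB.exists_subset_of_mem_open hzS.1 hS
    have huniq : ∀ y ∈ U ∩ W, f y = x → y = z := by
      intro y hy hfy
      have : y ∈ S ∩ (W ∩ f ⁻¹' {x}) := ⟨hUS hy.1, hy.2, hfy⟩
      rwa [hSz] at this
    have hxI : x ∈ I ⟨U, hUB⟩ := by
      refine ⟨⟨z, ⟨hzU, hzS.2.1⟩, hzS.2.2⟩, fun h => ?_⟩
      obtain ⟨⟨⟨S', T'⟩, hd⟩, ⟨y, hy, hfy⟩, ⟨y', hy', hfy'⟩⟩ := mem_iUnion.1 h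
      obtain rfl := huniq y hy.1 hfy
      obtain rfl := huniq y' hy'.1 hfy'
      exact disjoint_left.1 hd hy.2 hy'.2
    have hxJ' : x ∈ J ⟨U, hUB⟩ := (hxJ ⟨U, hUB⟩).symm.mp hxI
    -- By minimality `x` still has a preimage in `U` after the removal, yet `x ∈ J U` puts every
    -- such preimage into `P U`.
    obtain ⟨y, hy, hfy⟩ : x ∈ f '' (U ∩ (W \ ⋃ U, P U)) :=
      (hx ⟨U, hUB⟩).symm.mp ⟨z, ⟨hzU, hzS.2.1⟩, hzS.2.2⟩
    exact hy.2.2 (mem_iUnion.2 ⟨⟨U, hUB⟩, ⟨hy.1, hy.2.1⟩, by rw [mem_preimage, hfy]; exact hxJ'⟩)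
  intro z hz
  refine h𝒜cov fun hzW => ?_
  have : z ∈ W ∩ f ⁻¹' {x} := ⟨hzW, hz⟩
  rw [hempty] at this
  exact this

/-- A Borel map with countable fibres is, over almost every point, countably many Borel
injections. -/
theorem exists_nat_injOn_cover {X Z : Type*} [MeasurableSpace Z] [StandardBorelSpace Z]
    [MeasurableSpace X] [StandardBorelSpace X] (μ : Measure X) [IsFiniteMeasure μ] {f : Z → X}
    (hf : Measurable f) (hcount : ∀ x, (f ⁻¹' {x}).Countable) :
    ∃ A : ℕ → Set Z, (∀ n, MeasurableSet (A n)) ∧ (∀ n, InjOn f (A n)) ∧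
      ∀ᵐ x ∂μ, ∀ z, f z = x → ∃ n, z ∈ A n := by
  let _ := upgradeStandardBorel Z
  let _ := upgradeStandardBorel X
  -- Refine the Polish topology of `Z` so that `f` becomes continuous; the Borel sets do not change.
  obtain ⟨t', hle, hcont, hpol⟩ := hf.exists_continuous
  have hborel : @BorelSpace Z t' _ := by
    refine @BorelSpace.mk _ t' _ ?_
    rw [eq_borel_upgradeStandardBorel Z]
    exact (borel_eq_borel_of_le hpol UpgradedStandardBorel.toPolishSpace hle).symm
  obtain ⟨𝒜, hc, h𝒜, hcov⟩ := @exists_countable_injOn_cover_of_continuous X Z t' hpol _ hborel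
    _ _ _ _ μ _ f hcont hcount
  obtain ⟨A, hA⟩ := (hc.insert ∅).exists_eq_range (insert_nonempty _ _)
  have hAm : ∀ n, MeasurableSet (A n) ∧ InjOn f (A n) := by
    intro n
    have : A n ∈ insert ∅ 𝒜 := hA ▸ mem_range_self n
    rcases this with h | h
    · rw [h]
      exact ⟨MeasurableSet.empty, injOn_empty f⟩
    · exact h𝒜 _ h
  refine ⟨A, fun n => (hAm n).1, fun n => (hAm n).2, ?_⟩
  filter_upwards [hcov] with x hx z hz
  obtain ⟨S, hS, hzS⟩ := hx hz
  have : S ∈ range A := hA ▸ mem_insert_of_mem _ hS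
  obtain ⟨n, rfl⟩ := this
  exact ⟨n, hzS⟩

/-- Almost every class of a countable Borel equivalence relation is enumerated by countably many
Borel maps. -/
theorem exists_measurable_sections {X : Type*} [MeasurableSpace X] [StandardBorelSpace X]
    (μ : Measure X) [IsFiniteMeasure μ] {E : Setoid X}
    (hE : MeasurableSet {p : X × X | E p.1 p.2}) (hcount : ∀ x, {y | E x y}.Countable) :
    ∃ f : ℕ → X → X, (∀ n, Measurable (f n)) ∧ (∀ n x, E x (f n x)) ∧ f 0 = id ∧
      ∀ᵐ x ∂μ, ∀ y, E x y → ∃ n, f n x = y := by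
  let Z := {p : X × X | E p.1 p.2}
  have : StandardBorelSpace Z := hE.standardBorel
  let π : Z → X := fun p => p.1.1
  have hπ : Measurable π := measurable_fst.comp measurable_subtype_coe
  obtain ⟨A, hA, hinj, hcov⟩ := exists_nat_injOn_cover μ hπ (fun x => by
    refine ((hcount x).image fun y => (x, y)).preimage Subtype.val_injective |>.mono ?_
    rintro ⟨⟨a, b⟩, hab⟩ rfl
    exact ⟨b, hab, rfl⟩)
  have hemb : ∀ n, MeasurableEmbedding fun p : A n => π p := fun n => by
    have := (hA n).standardBorel
    exact (hπ.comp measurable_subtype_coe).measurableEmbedding (hinj n).injective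
  let g : ℕ → X → X := fun n =>
    Function.extend (fun p : A n => π p) (fun p => p.1.1.2) id
  have hg : ∀ n (p : A n), g n (π p) = p.1.1.2 := fun n p =>
    (hemb n).injective.extend_apply _ _ _
  refine ⟨fun n => Nat.casesOn n id g, ?_, ?_, rfl, ?_⟩
  · rintro (_ | n)
    · exact measurable_id
    · exact (hemb n).measurable_extend
        (measurable_snd.comp (measurable_subtype_coe.comp measurable_subtype_coe)) measurable_id
  · rintro (_ | n) x
    · exact E.refl x
    · by_cases hx : ∃ p : A n, π p = x
      · obtain ⟨p, rfl⟩ := hx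
        change E (π p) (g n (π p))
        rw [hg]
        exact p.1.2
      · change E x (g n x)
        rw [show g n x = id x from Function.extend_apply' _ _ _ hx]
        exact E.refl x
  · filter_upwards [hcov] with x hx y hy
    obtain ⟨n, hn⟩ := hx ⟨(x, y), hy⟩ rfl
    exact ⟨n + 1, hg n ⟨_, hn⟩⟩

/-! ### Null sets and equivalence classes -/

section NullSets

variable {X : Type*} [MeasurableSpace X] [StandardBorelSpace X] {μ : Measure X}
  [IsFiniteMeasure μ] {E : Setoid X}

/-- Borel maps which move points inside their classes are nonsingular. -/
theorem IsCountableMPEquivRel.quasiMeasurePreserving (hE : IsCountableMPEquivRel μ E)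
    {f : X → X} (hf : Measurable f) (hfE : ∀ x, E x (f x)) :
    Measure.QuasiMeasurePreserving f μ μ := by
  refine ⟨hf, Measure.AbsolutelyContinuous.mk fun N hN hN0 => ?_⟩
  -- The push-forward measure is essential: its null sets have `μ`-null preimages by definition,
  -- whereas for `μ` this is the claim being proved.
  obtain ⟨A, hA, hinj, hcov⟩ := exists_nat_injOn_cover (μ.map f) hf
    (fun y => (hE.countable_class y).mono fun x hx => by
      rw [mem_preimage, mem_singleton_iff] at hx
      rw [mem_ofPred_eq, ← hx]
      exact E.symm (hfE x))
  have hcov' : ∀ᵐ x ∂μ, ∃ n, x ∈ A n :=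
    (ae_of_ae_map hf.aemeasurable hcov).mono fun x hx => hx x rfl
  rw [Measure.map_apply hf hN]
  have hpiece : ∀ n, μ (A n ∩ f ⁻¹' N) = 0 := fun n => by
    rw [← hE.measure_image _ f ((hA n).inter (hf hN)) hf ((hinj n).mono inter_subset_left)
      fun x _ => hfE x]
    refine measure_mono_null ?_ hN0
    rintro _ ⟨x, hx, rfl⟩
    exact hx.2
  refine measure_mono_null (t := (⋃ n, A n ∩ f ⁻¹' N) ∪ {x | ¬ ∃ n, x ∈ A n}) (fun x hx => ?_)
    (measure_union_null (measure_iUnion_null hpiece) hcov')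
  by_cases h : ∃ n, x ∈ A n
  · obtain ⟨n, hn⟩ := h
    exact Or.inl (mem_iUnion.2 ⟨n, hn, hx⟩)
  · exact Or.inr h

/-- A property which holds almost everywhere holds on the whole class of almost every point. -/
theorem IsCountableMPEquivRel.ae_forall_class (hE : IsCountableMPEquivRel μ E) {P : X → Prop}
    (hP : ∀ᵐ x ∂μ, P x) : ∀ᵐ x ∂μ, ∀ y, E x y → P y := by
  obtain ⟨f, hf, hfE, -, hcov⟩ :=
    exists_measurable_sections μ hE.measurableSet hE.countable_class
  have h : ∀ᵐ x ∂μ, ∀ n, P (f n x) := ae_all_iff.2 fun n =>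
    (hE.quasiMeasurePreserving (hf n) (hfE n)).ae hP
  filter_upwards [h, hcov] with x hx hcx y hy
  obtain ⟨n, rfl⟩ := hcx y hy
  exact hx n

end NullSets

/-! ### Hilbert sums of isometries -/

section HilbertSums

variable {ι : Type*} {κ : Type*} {G : ι → Type*} {G' : κ → Type*}
  [∀ i, NormedAddCommGroup (G i)] [∀ i, InnerProductSpace ℂ (G i)]
  [∀ j, NormedAddCommGroup (G' j)] [∀ j, InnerProductSpace ℂ (G' j)]

/-- The isometry between Hilbert sums that applies `T j` to the coordinate `σ j`. -/
noncomputable def lpReindexMap (σ : κ ≃ ι) (T : ∀ j, G (σ j) →ₗᵢ[ℂ] G' j) :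
    lp G 2 →ₗᵢ[ℂ] lp G' 2 where
  toFun F := ⟨fun j => T j (F (σ j)), by
    refine memℓp_gen ?_
    have h := (lp.memℓp F).summable (by norm_num)
    simpa only [LinearIsometry.norm_map, Function.comp_def] using σ.summable_iff.2 h⟩
  map_add' F F' := by
    ext j
    exact map_add (T j) _ _
  map_smul' c F := by
    ext j
    exact map_smul (T j) _ _
  norm_map' F := by
    have h2 : (0 : ℝ) < (2 : ℝ≥0∞).toReal := by norm_num
    refine Real.rpow_left_injOn h2.ne' (norm_nonneg _) (norm_nonneg _) ?_
    change ‖_‖ ^ (2 : ℝ≥0∞).toReal = ‖_‖ ^ (2 : ℝ≥0∞).toReal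
    rw [lp.norm_rpow_eq_tsum h2, lp.norm_rpow_eq_tsum h2,
      ← σ.tsum_eq fun i => ‖F i‖ ^ (2 : ℝ≥0∞).toReal]
    exact tsum_congr fun j => by
      rw [← (T j).norm_map (F (σ j))]
      rfl

@[simp]
theorem lpReindexMap_apply (σ : κ ≃ ι) (T : ∀ j, G (σ j) →ₗᵢ[ℂ] G' j) (F : lp G 2) (j : κ) :
    lpReindexMap σ T F j = T j (F (σ j)) := rfl

theorem lpReindexMap_single [DecidableEq ι] [DecidableEq κ] (σ : κ ≃ ι)
    (T : ∀ j, G (σ j) →ₗᵢ[ℂ] G' j) (j : κ) (w : G (σ j)) :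
    lpReindexMap σ T (lp.single 2 (σ j) w) = lp.single 2 j (T j w) := by
  ext k
  rw [lpReindexMap_apply]
  by_cases h : k = j
  · subst h
    rw [lp.single_apply_self, lp.single_apply_self]
  · rw [lp.single_apply_ne _ _ _ h, lp.single_apply_ne _ _ _ (fun h' => h (σ.injective h')),
      map_zero]

/-- The range of an isometry from a complete space is closed, and it contains all finitely supported
vectors. -/
theorem lpReindexMap_surjective [∀ i, CompleteSpace (G i)] (σ : κ ≃ ι)
    (T : ∀ j, G (σ j) ≃ₗᵢ[ℂ] G' j) :
    Function.Surjective (lpReindexMap σ fun j => (T j).toLinearIsometry) := by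
  classical
  intro F
  have hclosed : IsClosed (range (lpReindexMap σ fun j => (T j).toLinearIsometry)) :=
    (LinearIsometry.isometry _).isClosedEmbedding.isClosed_range
  refine hclosed.mem_of_tendsto (lp.hasSum_single (by norm_num) F)
    (Eventually.of_forall fun s => ?_)
  refine ⟨∑ j ∈ s, lp.single 2 (σ j) ((T j).symm (F j)), ?_⟩
  rw [map_sum]
  refine Finset.sum_congr rfl fun j _ => ?_
  rw [lpReindexMap_single]
  simp

/-- The unitary between Hilbert sums that applies `T j` to the coordinate `σ j`. -/
noncomputable def lpReindex [∀ i, CompleteSpace (G i)] (σ : κ ≃ ι)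
    (T : ∀ j, G (σ j) ≃ₗᵢ[ℂ] G' j) : lp G 2 ≃ₗᵢ[ℂ] lp G' 2 :=
  LinearIsometryEquiv.ofSurjective _ (lpReindexMap_surjective σ T)

end HilbertSums

/-- A coordinatewise bound for the norm in a Hilbert sum. -/
theorem lp_norm_le_of_forall_le {ι : Type*} {κ : Type*} {G : ι → Type*} {G' : κ → Type*}
    [∀ i, NormedAddCommGroup (G i)] [∀ j, NormedAddCommGroup (G' j)] {F : lp G 2} {F' : lp G' 2}
    (σ : κ ≃ ι) {c : ℝ} (hc : 0 ≤ c)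
    (h : ∀ j, ‖F' j‖ ≤ c * ‖F (σ j)‖) : ‖F'‖ ≤ c * ‖F‖ := by
  have h2 : (0 : ℝ) < (2 : ℝ≥0∞).toReal := by norm_num
  refine lp.norm_le_of_forall_sum_le h2 (by positivity) fun s => ?_
  calc ∑ j ∈ s, ‖F' j‖ ^ (2 : ℝ≥0∞).toReal
      ≤ ∑ j ∈ s, c ^ (2 : ℝ≥0∞).toReal * ‖F (σ j)‖ ^ (2 : ℝ≥0∞).toReal :=
        Finset.sum_le_sum fun j _ => by
          rw [← Real.mul_rpow hc (norm_nonneg _)]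
          exact Real.rpow_le_rpow (norm_nonneg _) (h j) h2.le
    _ = c ^ (2 : ℝ≥0∞).toReal * ∑ i ∈ s.map σ.toEmbedding, ‖F i‖ ^ (2 : ℝ≥0∞).toReal := by
        rw [Finset.mul_sum, Finset.sum_map]
        rfl
    _ ≤ (c * ‖F‖) ^ (2 : ℝ≥0∞).toReal := by
        rw [Real.mul_rpow hc (norm_nonneg _)]
        gcongr
        exact lp.sum_rpow_le_norm_rpow h2 F _

/-! ### Separable Hilbert spaces -/

section Separable

variable {H : Type u} [NormedAddCommGroup H] [InnerProductSpace ℂ H]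

/-- Distinct members are at distance √2, so the balls of radius 1/2 around them are disjoint. -/
theorem countable_of_orthonormal {ι : Type*} [TopologicalSpace.SeparableSpace H] {b : ι → H}
    (hb : Orthonormal ℂ b) : Countable ι := by
  rw [← Set.countable_univ_iff]
  refine Set.PairwiseDisjoint.countable_of_isOpen (s := fun i => Metric.ball (b i) (1 / 2))
    (fun i _ j _ hij => ?_) (fun i _ => Metric.isOpen_ball)
    (fun i _ => ⟨b i, Metric.mem_ball_self (by norm_num)⟩)
  refine Metric.ball_disjoint_ball ?_
  have h : ‖b i - b j‖ * ‖b i - b j‖ = 2 := by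
    rw [@norm_sub_mul_self ℂ, hb.2 hij, hb.1 i, hb.1 j]
    norm_num
  rw [dist_eq_norm]
  nlinarith [norm_nonneg (b i - b j)]

/-- Every separable Hilbert space has a copy in every universe. -/
theorem exists_linearIsometryEquiv_separable [CompleteSpace H]
    [TopologicalSpace.SeparableSpace H] :
    ∃ (K : Type v) (_ : NormedAddCommGroup K) (_ : InnerProductSpace ℂ K) (_ : CompleteSpace K)
      (_ : TopologicalSpace.SeparableSpace K), Nonempty (H ≃ₗᵢ[ℂ] K) := by
  obtain ⟨s, b, -⟩ := exists_hilbertBasis ℂ H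
  have := countable_of_orthonormal b.orthonormal
  obtain ⟨φ, hφ⟩ := exists_injective_nat s
  let e : ULift.{v} (range φ) ≃ s := Equiv.ulift.trans (Equiv.ofInjective φ hφ).symm
  have he : range (b ∘ e) = range b := e.surjective.range_comp b
  let b' : HilbertBasis (ULift.{v} (range φ)) ℂ H :=
    HilbertBasis.mk (b.orthonormal.comp e e.injective) (by rw [he, b.dense_span])
  refine ⟨lp (fun _ : ULift.{v} (range φ) => ℂ) 2, inferInstance, inferInstance, inferInstance,
    ?_, ⟨b'.repr⟩⟩
  exact b'.repr.surjective.denseRange.separableSpace b'.repr.continuous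

end Separable

/-! ### Nearby extensions -/

section NearbyExtension

variable {Γ : Type u} [Group Γ] {H : Type v} [NormedAddCommGroup H] [InnerProductSpace ℂ H]

/-- The map `π` into the unitaries of `H` extends to a map into the unitaries of a larger Hilbert
space which is uniformly `ε`-close to a representation. -/
def HasNearbyExtension (ε : ℝ) (π : Γ → H ≃ₗᵢ[ℂ] H) : Prop :=
  ∃ (H' : Type w) (_ : NormedAddCommGroup H') (_ : InnerProductSpace ℂ H')
    (_ : CompleteSpace H') (V : H →ₗᵢ[ℂ] H') (π' π₁ : Γ → H' ≃ₗᵢ[ℂ] H'),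
    π' 1 = 1 ∧ (∀ g ξ, π' g (V ξ) = V (π g ξ)) ∧ (∀ g h, π₁ (g * h) = π₁ g * π₁ h) ∧
    ∀ g ξ, ‖π' g ξ - π₁ g ξ‖ ≤ ε * ‖ξ‖

/-- A nearby extension on a separable space can be found in every universe. -/
theorem HasNearbyExtension.of_separable {ε : ℝ} {π : Γ → H ≃ₗᵢ[ℂ] H}
    {H' : Type w} [NormedAddCommGroup H'] [InnerProductSpace ℂ H'] [CompleteSpace H']
    [TopologicalSpace.SeparableSpace H'] (V : H →ₗᵢ[ℂ] H') (π' π₁ : Γ → H' ≃ₗᵢ[ℂ] H')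
    (h1 : π' 1 = 1) (hV : ∀ g ξ, π' g (V ξ) = V (π g ξ))
    (hmul : ∀ g h, π₁ (g * h) = π₁ g * π₁ h) (hε : ∀ g ξ, ‖π' g ξ - π₁ g ξ‖ ≤ ε * ‖ξ‖) :
    HasNearbyExtension.{u, v, z} ε π := by
  obtain ⟨K, _, _, _, _, ⟨Φ⟩⟩ := exists_linearIsometryEquiv_separable.{w, z} (H := H')
  refine ⟨K, inferInstance, inferInstance, inferInstance, Φ.toLinearIsometry.comp V,
    fun g => (Φ.symm.trans (π' g)).trans Φ, fun g => (Φ.symm.trans (π₁ g)).trans Φ,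
    ?_, ?_, ?_, ?_⟩
  · ext ξ
    simp [h1]
  · intro g ξ
    simp [hV]
  · intro g h
    ext ξ
    simp [hmul]
  · intro g ξ
    simpa [← map_sub] using hε g (Φ.symm ξ)

/-- Nearby extensions may be transported along an isometry of the extended space. -/
theorem HasNearbyExtension.of_equiv {ε : ℝ} {π : Γ → H ≃ₗᵢ[ℂ] H}
    {K : Type*} [NormedAddCommGroup K] [InnerProductSpace ℂ K] (Φ : H ≃ₗᵢ[ℂ] K)
    (hπ : HasNearbyExtension.{_, _, w} ε fun g => (Φ.symm.trans (π g)).trans Φ) :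
    HasNearbyExtension.{_, _, w} ε π := by
  obtain ⟨H', _, _, _, V, π', π₁, h1, hV, hmul, hε⟩ := hπ
  refine ⟨H', inferInstance, inferInstance, inferInstance, V.comp Φ.toLinearIsometry, π', π₁,
    h1, fun g ξ => ?_, hmul, hε⟩
  simpa using hV g (Φ ξ)

/-- Hilbert sums of maps with nearby extensions have nearby extensions. -/
theorem HasNearbyExtension.hilbertSum {ι : Type w} {ε : ℝ} (hε : 0 ≤ ε) {C : ι → Type v}
    [∀ i, NormedAddCommGroup (C i)] [∀ i, InnerProductSpace ℂ (C i)] [∀ i, CompleteSpace (C i)]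
    {π : ∀ i, Γ → C i ≃ₗᵢ[ℂ] C i} (hπ : ∀ i, HasNearbyExtension.{u, v, z} ε (π i)) :
    HasNearbyExtension.{u, max v w, max w z} ε
      fun g => lpReindex (Equiv.refl ι) fun i => π i g := by
  choose H' i1 i2 i3 V π' π₁ h1 hV hmul hεi using hπ
  refine ⟨lp H' 2, inferInstance, inferInstance, inferInstance,
    lpReindexMap (Equiv.refl ι) V, fun g => lpReindex (Equiv.refl ι) fun i => π' i g,
    fun g => lpReindex (Equiv.refl ι) fun i => π₁ i g, ?_, ?_, ?_, ?_⟩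
  · ext F i
    simp only [h1]
    rfl
  · intro g F
    ext i
    exact hV i g (F i)
  · intro g h
    ext F i
    simp only [hmul]
    rfl
  · intro g F
    exact lp_norm_le_of_forall_le (Equiv.refl ι) hε fun i => hεi i g (F i)

end NearbyExtension

/-! ### Reduction to separable spaces -/

section Cyclic

variable {F : Type u} [Group F] {H : Type v} [NormedAddCommGroup H] [InnerProductSpace ℂ H]

/-- The closed invariant subspace generated by a vector. -/
noncomputable def cyclicSubspace (Θ : F →* (H ≃ₗᵢ[ℂ] H)) (b : H) : Submodule ℂ H :=
  (Submodule.span ℂ (range fun w => Θ w b)).topologicalClosure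

theorem unitary_hom_apply_apply (Θ : F →* (H ≃ₗᵢ[ℂ] H)) (w w' : F) (b : H) :
    Θ w (Θ w' b) = Θ (w * w') b := by
  rw [map_mul]
  rfl

theorem mem_cyclicSubspace (Θ : F →* (H ≃ₗᵢ[ℂ] H)) (b : H) (w : F) :
    Θ w b ∈ cyclicSubspace Θ b :=
  Submodule.le_topologicalClosure _ (Submodule.subset_span ⟨w, rfl⟩)

theorem map_mem_cyclicSubspace (Θ : F →* (H ≃ₗᵢ[ℂ] H)) (b : H) (w : F) {ξ : H}
    (hξ : ξ ∈ cyclicSubspace Θ b) : Θ w ξ ∈ cyclicSubspace Θ b := by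
  have hle : cyclicSubspace Θ b ≤
      (cyclicSubspace Θ b).comap (Θ w).toLinearEquiv.toLinearMap := by
    refine Submodule.topologicalClosure_minimal _ (Submodule.span_le.2 ?_) ?_
    · rintro _ ⟨w', rfl⟩
      have := mem_cyclicSubspace Θ b (w * w')
      rwa [← unitary_hom_apply_apply] at this
    · exact (Submodule.isClosed_topologicalClosure _).preimage (Θ w).continuous
  exact hle hξ

theorem separableSpace_cyclicSubspace [Countable F] (Θ : F →* (H ≃ₗᵢ[ℂ] H)) (b : H) :
    TopologicalSpace.SeparableSpace (cyclicSubspace Θ b) :=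
  ((countable_range fun w => Θ w b).isSeparable.span (R := ℂ)).closure.separableSpace

/-- Every Hilbert space is the Hilbert sum of cyclic subspaces. -/
theorem exists_isHilbertSum_cyclicSubspace [CompleteSpace H] (Θ : F →* (H ≃ₗᵢ[ℂ] H)) :
    ∃ B : Set H, IsHilbertSum ℂ (fun b : B => cyclicSubspace Θ b)
      fun b : B => (cyclicSubspace Θ b).subtypeₗᵢ := by
  obtain ⟨B, hB⟩ := zorn_subset
    {B : Set H | ∀ b ∈ B, ∀ b' ∈ B, b ≠ b' → ∀ w, inner ℂ b (Θ w b') = 0} (by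
      intro c hc hchain
      refine ⟨⋃₀ c, ?_, fun s hs => subset_sUnion_of_mem hs⟩
      rintro b ⟨s, hs, hb⟩ b' ⟨s', hs', hb'⟩
      rcases hchain.total hs hs' with h | h
      · exact hc hs' b (h hb) b' hb'
      · exact hc hs b hb b' (h hb'))
  have hinner : ∀ (b b' : H) (w w' : F), inner ℂ (Θ w b) (Θ w' b') =
      inner ℂ b (Θ (w⁻¹ * w') b') := by
    intro b b' w w'
    rw [← (Θ w).inner_map_map b, unitary_hom_apply_apply, mul_inv_cancel_left]
  have hcomplete : ∀ b, CompleteSpace (cyclicSubspace Θ b) := fun b =>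
    (Submodule.isClosed_topologicalClosure _).completeSpace_coe
  refine ⟨B, IsHilbertSum.mkInternal _ (OrthogonalFamily.of_pairwise fun b b' hbb' => ?_) ?_⟩
  · change cyclicSubspace Θ b ⟂ cyclicSubspace Θ b'
    rw [cyclicSubspace, cyclicSubspace, Submodule.isOrtho_iff_le,
      Submodule.orthogonal_closure]
    refine Submodule.topologicalClosure_minimal _ ?_ (Submodule.isClosed_orthogonal _)
    rw [← Submodule.isOrtho_iff_le, Submodule.isOrtho_span]
    rintro _ ⟨w, rfl⟩ _ ⟨w', rfl⟩
    rw [hinner]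
    exact hB.prop b b.2 b' b'.2 (fun h => hbb' (Subtype.ext h)) _
  · rw [top_le_iff, Submodule.topologicalClosure_eq_top_iff, Submodule.eq_bot_iff]
    intro ξ hξ
    have hort : ∀ b ∈ B, ∀ w, inner ℂ (Θ w b) ξ = 0 := fun b hb w =>
      (Submodule.mem_orthogonal _ _).1 hξ _
        (Submodule.mem_iSup_of_mem ⟨b, hb⟩ (mem_cyclicSubspace Θ b w))
    have hins : insert ξ B ∈
        {B : Set H | ∀ b ∈ B, ∀ b' ∈ B, b ≠ b' → ∀ w, inner ℂ b (Θ w b') = 0} := by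
      rintro b (rfl | hb) b' (rfl | hb') hne w
      · exact (hne rfl).elim
      · rw [← inner_conj_symm, hort b' hb' w, map_zero]
      · have h := hinner b b' w⁻¹ 1
        simp only [inv_inv, mul_one, map_one, LinearIsometryEquiv.coe_one, id_eq] at h
        rw [← h]
        exact hort b hb _
      · exact hB.prop b hb b' hb' hne w
    -- Maximality puts `ξ` into `B`, so `ξ` is orthogonal to its own cyclic subspace and vanishes.
    have hξB : ξ ∈ B := hB.le_of_ge hins (subset_insert _ _) (mem_insert _ _)
    have := hort ξ hξB 1
    simpa using this

end Cyclic

section Reduction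

variable {Γ : Type u} [Group Γ] {H : Type v} [NormedAddCommGroup H] [InnerProductSpace ℂ H]

/-- It suffices to find nearby extensions of almost representations on separable spaces. -/
theorem hasNearbyExtension_of_forall_separable [Countable Γ] [CompleteSpace H] {ε δ : ℝ}
    (hε : 0 ≤ ε)
    (hsep : ∀ (K : Type v) [NormedAddCommGroup K] [InnerProductSpace ℂ K] [CompleteSpace K]
      [TopologicalSpace.SeparableSpace K] (π : Γ → K ≃ₗᵢ[ℂ] K), π 1 = 1 →
      (∀ g h ξ, ‖π g (π h ξ) - π (g * h) ξ‖ ≤ δ * ‖ξ‖) → HasNearbyExtension.{u, v, v} ε π)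
    (π : Γ → H ≃ₗᵢ[ℂ] H) (h1 : π 1 = 1)
    (hδ : ∀ g h ξ, ‖π g (π h ξ) - π (g * h) ξ‖ ≤ δ * ‖ξ‖) :
    HasNearbyExtension.{u, v, v} ε π := by
  -- Since `π` is not multiplicative, orbits under `π` need not be invariant. The free group gives a
  -- genuine action, is still countable, and its invariant subspaces are preserved by each `π g` and
  -- its inverse.
  let Θ : FreeGroup Γ →* (H ≃ₗᵢ[ℂ] H) := FreeGroup.lift π
  have hΘ : ∀ g, Θ (FreeGroup.of g) = π g := fun g => FreeGroup.lift_apply_of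
  obtain ⟨B, hB⟩ := exists_isHilbertSum_cyclicSubspace Θ
  have hcomplete : ∀ b, CompleteSpace (cyclicSubspace Θ b) := fun b =>
    (Submodule.isClosed_topologicalClosure _).completeSpace_coe
  have hmaps : ∀ (b : H) (g : Γ), ∀ ξ ∈ cyclicSubspace Θ b, π g ξ ∈ cyclicSubspace Θ b :=
    fun b g ξ hξ => by
      rw [← hΘ g]
      exact map_mem_cyclicSubspace Θ b _ hξ
  let T : ∀ b : B, Γ → cyclicSubspace Θ b →ₗᵢ[ℂ] cyclicSubspace Θ b := fun b g =>
    ⟨(π g).toLinearEquiv.toLinearMap.restrict (hmaps b g), fun ξ => (π g).norm_map ξ⟩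
  have hT : ∀ b g, Function.Surjective (T b g) := by
    intro b g ξ
    refine ⟨⟨Θ (FreeGroup.of g)⁻¹ ξ, map_mem_cyclicSubspace Θ b _ ξ.2⟩, Subtype.ext ?_⟩
    change π g (Θ (FreeGroup.of g)⁻¹ ξ) = ξ
    rw [← hΘ g, unitary_hom_apply_apply, mul_inv_cancel, map_one]
    rfl
  let ρ : ∀ b : B, Γ → cyclicSubspace Θ b ≃ₗᵢ[ℂ] cyclicSubspace Θ b := fun b g =>
    LinearIsometryEquiv.ofSurjective (T b g) (hT b g)
  have hρ : ∀ b g ξ, (ρ b g ξ : H) = π g ξ := fun b g ξ => rfl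
  have hsum := HasNearbyExtension.hilbertSum.{u, v, v, v} hε (π := ρ) fun b => by
    have := separableSpace_cyclicSubspace Θ (b : H)
    refine hsep _ (ρ b) ?_ fun g h ξ => hδ g h ξ
    ext ξ
    rw [hρ, h1]
    rfl
  refine HasNearbyExtension.of_equiv hB.linearIsometryEquiv ?_
  convert hsum using 2 with g
  ext1 w
  rw [LinearIsometryEquiv.trans_apply, LinearIsometryEquiv.trans_apply,
    ← LinearIsometryEquiv.eq_symm_apply]
  have e1 := (hB.hasSum_linearIsometryEquiv_symm w).mapL
    ((π g).toContinuousLinearEquiv : H →L[ℂ] H)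
  exact e1.unique (hB.hasSum_linearIsometryEquiv_symm _)

end Reduction

/-! ### Matching of enumerations -/

section Matching

variable {Z : Type*}

/-- For enumerations `κ`, `κ'` of the same set, the index in `κ'` of the `k`-th element of `κ`. -/
noncomputable def matching (κ κ' : ℕ → Z) (k : ℕ) : ℕ := sInf {l | κ' l = κ k}

theorem apply_matching {κ κ' : ℕ → Z} (h : range κ = range κ') (k : ℕ) :
    κ' (matching κ κ' k) = κ k :=
  Nat.sInf_mem (s := {l | κ' l = κ k}) (h ▸ mem_range_self k : κ k ∈ range κ')

theorem matching_eq_iff {κ κ' : ℕ → Z} (h : range κ = range κ') (hκ' : Function.Injective κ')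
    {k l : ℕ} : matching κ κ' k = l ↔ κ' l = κ k := by
  rw [← apply_matching h k, hκ'.eq_iff, eq_comm]

theorem matching_bijective {κ κ' : ℕ → Z} (h : range κ = range κ') (hκ : Function.Injective κ)
    (hκ' : Function.Injective κ') : Function.Bijective (matching κ κ') := by
  refine ⟨fun k l hkl => hκ ?_, fun l => ⟨matching κ' κ l, ?_⟩⟩
  · rw [← apply_matching h, ← apply_matching h, hkl]
  · rw [matching_eq_iff h hκ', apply_matching h.symm]

theorem matching_matching {κ κ' κ'' : ℕ → Z} (h : range κ = range κ') (h' : range κ' = range κ'')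
    (hκ'' : Function.Injective κ'') (k : ℕ) :
    matching κ' κ'' (matching κ κ' k) = matching κ κ'' k := by
  rw [matching_eq_iff h' hκ'', apply_matching (h.trans h'), apply_matching h]

theorem matching_self {κ : ℕ → Z} (hκ : Function.Injective κ) (k : ℕ) : matching κ κ k = k :=
  (matching_eq_iff rfl hκ).2 rfl

open Classical in
/-- The terms of a sequence, together with the number of their previous occurrences. -/
noncomputable def rankedLabel (c : ℕ → Z) (k : ℕ) : Z × ℕ :=
  (c k, Nat.count (fun k' => c k' = c k) k)

theorem rankedLabel_injective (c : ℕ → Z) : Function.Injective (rankedLabel c) := by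
  classical
  intro k l h
  obtain ⟨h1, h2⟩ := Prod.ext_iff.1 h
  simp only [rankedLabel] at h1 h2
  simp only [h1] at h2
  exact Nat.count_injective (p := fun k' => c k' = c l) h1 rfl (by convert h2)

/-- Each term recurs infinitely often, so every rank is attained; the range then depends only on
which terms occur, not on their order. -/
theorem range_rankedLabel {c : ℕ → Z} (hc : ∀ k, {l | c l = c k}.Infinite) :
    range (rankedLabel c) = {q | q.1 ∈ range c} := by
  classical
  ext ⟨q, n⟩
  constructor
  · rintro ⟨k, hk⟩
    exact ⟨k, congrArg Prod.fst hk⟩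
  · rintro ⟨k, rfl⟩
    have hmem : c (Nat.nth (fun l => c l = c k) n) = c k := Nat.nth_mem_of_infinite (hc k) n
    refine ⟨Nat.nth (fun l => c l = c k) n, Prod.ext hmem ?_⟩
    simp only [rankedLabel, hmem]
    convert Nat.count_nth_of_infinite (hc k) n

end Matching

/-! ### The induced cocycle -/

section Induced

variable {Γ : Type u} [Group Γ] {X : Type z} [MulAction Γ X]

/-- The index of a group element which moves `x` to `y`. -/
noncomputable def orbitCode (e : ℕ → Γ) (x y : X) : ℕ := sInf {n | e n • x = y}

theorem orbitCode_smul {e : ℕ → Γ} (he : Function.Surjective e) {x y : X}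
    (h : ∃ g : Γ, g • x = y) : e (orbitCode e x y) • x = y := by
  obtain ⟨g, hg⟩ := h
  obtain ⟨n, rfl⟩ := he g
  exact Nat.sInf_mem (s := {n | e n • x = y}) ⟨n, hg⟩

theorem orbitCode_eq_of_free {e : ℕ → Γ} (he : Function.Surjective e) {x y : X} {g : Γ}
    (hfree : ∀ g : Γ, g • x = x → g = 1) (hg : g • x = y) : e (orbitCode e x y) = g := by
  have h := orbitCode_smul he ⟨g, hg⟩
  have : (g⁻¹ * e (orbitCode e x y)) • x = x := by
    rw [mul_smul, h, ← hg, inv_smul_smul]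
  exact (inv_mul_eq_one.1 (hfree _ this)).symm

/-- The orbits of the points `f n x`, each one listed infinitely often. -/
def orbitSeq (Γ : Type u) [Group Γ] [MulAction Γ X] (f : ℕ → X → X) (x : X) (k : ℕ) :
    MulAction.orbitRel.Quotient Γ X :=
  Quotient.mk (MulAction.orbitRel Γ X) (f k.unpair.1 x)

/-- An enumeration of the pairs of an orbit met by the points `f n x` and a natural number. -/
noncomputable def orbitLabel (Γ : Type u) [Group Γ] [MulAction Γ X] (f : ℕ → X → X) (x : X) :
    ℕ → MulAction.orbitRel.Quotient Γ X × ℕ :=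
  rankedLabel (orbitSeq Γ f x)

theorem orbitLabel_injective (f : ℕ → X → X) (x : X) :
    Function.Injective (orbitLabel Γ f x) := rankedLabel_injective _

theorem orbitSeq_infinite (f : ℕ → X → X) (x : X) (k : ℕ) :
    {l | orbitSeq Γ f x l = orbitSeq Γ f x k}.Infinite := by
  refine Set.infinite_of_injective_forall_mem (f := fun m => Nat.pair k.unpair.1 m)
    (fun a b h => (Nat.pair_eq_pair.1 h).2) fun m => ?_
  simp [orbitSeq]

theorem mk_eq_mk_iff_exists_smul {x y : X} :
    Quotient.mk (MulAction.orbitRel Γ X) x = Quotient.mk (MulAction.orbitRel Γ X) y ↔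
      ∃ g : Γ, g • x = y := by
  rw [Quotient.eq, MulAction.orbitRel_apply, MulAction.mem_orbit_symm]
  exact Iff.rfl

/-- All points of the class of `x` have trivial stabilizers, orbits contained in the class, and
a class enumerated by the maps `f n`. -/
def IsRegularPoint (Γ : Type u) [Group Γ] [MulAction Γ X] (E : Setoid X) (f : ℕ → X → X)
    (x : X) : Prop :=
  ∀ y, E x y → (∀ g : Γ, g • y = y → g = 1) ∧ (∀ g : Γ, E y (g • y)) ∧
    ∀ z, E y z → ∃ n, f n y = z

variable {E : Setoid X} {f : ℕ → X → X}

theorem IsRegularPoint.of_rel {x y : X} (hx : IsRegularPoint Γ E f x) (hxy : E x y) :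
    IsRegularPoint Γ E f y := fun w hw => hx w (E.trans hxy hw)

/-- The right-hand side depends only on the class of `x`; this is what makes matchings between
related points bijective. -/
theorem IsRegularPoint.range_orbitLabel (hfE : ∀ n x, E x (f n x)) {x : X}
    (hx : IsRegularPoint Γ E f x) :
    range (orbitLabel Γ f x) = {q | ∃ y, E x y ∧ q.1 = Quotient.mk _ y} := by
  rw [orbitLabel, range_rankedLabel (orbitSeq_infinite f x)]
  ext q
  constructor
  · rintro ⟨k, hk⟩
    exact ⟨_, hfE _ _, hk.symm⟩
  · rintro ⟨y, hy, hq⟩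
    obtain ⟨n, rfl⟩ := (hx x (E.refl x)).2.2 y hy
    exact ⟨Nat.pair n 0, by simp [orbitSeq, hq]⟩

theorem IsRegularPoint.range_orbitLabel_eq (hfE : ∀ n x, E x (f n x)) {x y : X}
    (hx : IsRegularPoint Γ E f x) (hxy : E x y) :
    range (orbitLabel Γ f x) = range (orbitLabel Γ f y) := by
  rw [hx.range_orbitLabel hfE, (hx.of_rel hxy).range_orbitLabel hfE]
  ext q
  exact exists_congr fun w => and_congr_left' ⟨E.trans (E.symm hxy), E.trans hxy⟩

/-- Matched indices belong to points of the same orbit. -/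
theorem exists_smul_of_orbitLabel_eq {x y : X} {k l : ℕ}
    (h : orbitLabel Γ f x k = orbitLabel Γ f y l) :
    ∃ g : Γ, g • f k.unpair.1 x = f l.unpair.1 y :=
  mk_eq_mk_iff_exists_smul.1 (congrArg Prod.fst h)

variable {H : Type v} [NormedAddCommGroup H] [InnerProductSpace ℂ H] [CompleteSpace H]

open Classical in
/-- The quasirepresentation of `E` induced from a quasirepresentation `π` of a group which acts
inside the classes of `E`. -/
noncomputable def inducedCocycle (e : ℕ → Γ) (f : ℕ → X → X) (π : Γ → H ≃ₗᵢ[ℂ] H) (x y : X) :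
    lp (fun _ : ℕ => H) 2 ≃ₗᵢ[ℂ] lp (fun _ : ℕ => H) 2 :=
  if h : Function.Bijective (matching (orbitLabel Γ f y) (orbitLabel Γ f x)) then
    lpReindex (Equiv.ofBijective _ h) fun j => π (e (orbitCode e
      (f (matching (orbitLabel Γ f y) (orbitLabel Γ f x) j).unpair.1 x) (f j.unpair.1 y)))
  else 1

variable {e : ℕ → Γ} {π : Γ → H ≃ₗᵢ[ℂ] H}

theorem inducedCocycle_apply_of_bijective {x y : X}
    (h : Function.Bijective (matching (orbitLabel Γ f y) (orbitLabel Γ f x)))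
    (F : lp (fun _ : ℕ => H) 2) (j : ℕ) :
    inducedCocycle e f π x y F j = π (e (orbitCode e
      (f (matching (orbitLabel Γ f y) (orbitLabel Γ f x) j).unpair.1 x) (f j.unpair.1 y)))
      (F (matching (orbitLabel Γ f y) (orbitLabel Γ f x) j)) := by
  rw [inducedCocycle, dif_pos h]
  rfl

theorem inducedCocycle_apply (hfE : ∀ n x, E x (f n x)) {x y : X}
    (hx : IsRegularPoint Γ E f x) (hxy : E x y) (F : lp (fun _ : ℕ => H) 2) (j : ℕ) :
    inducedCocycle e f π x y F j = π (e (orbitCode e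
      (f (matching (orbitLabel Γ f y) (orbitLabel Γ f x) j).unpair.1 x) (f j.unpair.1 y)))
      (F (matching (orbitLabel Γ f y) (orbitLabel Γ f x) j)) :=
  inducedCocycle_apply_of_bijective (matching_bijective (hx.range_orbitLabel_eq hfE hxy).symm
    (orbitLabel_injective f y) (orbitLabel_injective f x)) F j

theorem inducedCocycle_self (he : Function.Surjective e) (hfE : ∀ n x, E x (f n x))
    (h1 : π 1 = 1) {x : X} (hx : IsRegularPoint Γ E f x) : inducedCocycle e f π x x = 1 := by
  ext F j
  rw [inducedCocycle_apply hfE hx (E.refl x), matching_self (orbitLabel_injective f x),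
    orbitCode_eq_of_free he (hx _ (hfE _ _)).1 (one_smul Γ _), h1]
  rfl

/-- The induced quasirepresentation has at most the defect of the given one. -/
theorem norm_inducedCocycle_mul_sub_le (he : Function.Surjective e) (hfE : ∀ n x, E x (f n x))
    {δ : ℝ} (hδ0 : 0 ≤ δ) (hδ : ∀ g h ξ, ‖π g (π h ξ) - π (g * h) ξ‖ ≤ δ * ‖ξ‖) {x y z : X}
    (hx : IsRegularPoint Γ E f x) (hxy : E x y) (hyz : E y z) (F : lp (fun _ : ℕ => H) 2) :
    ‖inducedCocycle e f π y z (inducedCocycle e f π x y F) - inducedCocycle e f π x z F‖ ≤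
      δ * ‖F‖ := by
  have hxy' := hx.range_orbitLabel_eq hfE hxy
  have hyz' := (hx.of_rel hxy).range_orbitLabel_eq hfE hyz
  have hinj := orbitLabel_injective (Γ := Γ) f
  have hb : Function.Bijective (matching (orbitLabel Γ f z) (orbitLabel Γ f x)) :=
    matching_bijective (hxy'.trans hyz').symm (hinj z) (hinj x)
  refine lp_norm_le_of_forall_le (Equiv.ofBijective _ hb) hδ0 fun j => ?_
  rw [lp.coeFn_sub, Pi.sub_apply, inducedCocycle_apply hfE (hx.of_rel hxy) hyz,
    inducedCocycle_apply hfE hx hxy, inducedCocycle_apply hfE hx (E.trans hxy hyz),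
    matching_matching hyz'.symm hxy'.symm (hinj x), Equiv.ofBijective_apply]
  set k := matching (orbitLabel Γ f z) (orbitLabel Γ f x) j with hk
  set l := matching (orbitLabel Γ f z) (orbitLabel Γ f y) j with hl
  have hkj : orbitLabel Γ f x k = orbitLabel Γ f z j := apply_matching (hxy'.trans hyz').symm j
  have hlj : orbitLabel Γ f y l = orbitLabel Γ f z j := apply_matching hyz'.symm j
  obtain ⟨g, hg⟩ := exists_smul_of_orbitLabel_eq (hkj.trans hlj.symm)
  obtain ⟨h, hh⟩ := exists_smul_of_orbitLabel_eq hlj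
  have hfx := (hx _ (hfE k.unpair.1 x)).1
  have hfy := (hx.of_rel hxy _ (hfE l.unpair.1 y)).1
  rw [orbitCode_eq_of_free he hfx hg, orbitCode_eq_of_free he hfy hh,
    -- The permutations agree, and the three base points are linked by `g`, `h` and, by freeness, `h
    -- * g`; only the defect of `π` at `(h, g)` is left.
    orbitCode_eq_of_free he hfx (g := h * g) (by rw [mul_smul, hg, hh])]
  exact hδ h g _

/-- Along the orbits, the induced quasirepresentation extends the given one. -/
theorem inducedCocycle_single_zero (he : Function.Surjective e) (hfE : ∀ n x, E x (f n x))
    (hf0 : f 0 = id) {x : X} (hx : IsRegularPoint Γ E f x) (g : Γ) (ξ : H) :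
    inducedCocycle e f π x (g • x) (lp.single 2 0 ξ) = lp.single 2 0 (π g ξ) := by
  have hxg : E x (g • x) := (hx x (E.refl x)).2.1 g
  have hr := hx.range_orbitLabel_eq hfE hxg
  have hinj := orbitLabel_injective (Γ := Γ) f
  have h0 : matching (orbitLabel Γ f (g • x)) (orbitLabel Γ f x) 0 = 0 := by
    rw [matching_eq_iff hr.symm (hinj x)]
    -- Index 0 has no earlier occurrences, so its rank is 0 at either point, and `f 0 = id` makes
    -- its orbit that of the point itself.
    refine Prod.ext ?_ rfl
    change orbitSeq Γ f x 0 = orbitSeq Γ f (g • x) 0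
    simp only [orbitSeq, Nat.unpair_zero, Prod.fst_zero, hf0]
    exact mk_eq_mk_iff_exists_smul.2 ⟨g, rfl⟩
  ext j
  rw [inducedCocycle_apply hfE hx hxg]
  by_cases hj : j = 0
  · subst hj
    rw [h0, lp.single_apply_self, lp.single_apply_self]
    simp only [Nat.unpair_zero, Prod.fst_zero, hf0, id_eq]
    rw [orbitCode_eq_of_free he (hx x (E.refl x)).1 rfl]
  · have hne : matching (orbitLabel Γ f (g • x)) (orbitLabel Γ f x) j ≠ 0 := fun h =>
      hj ((matching_bijective hr.symm (hinj _) (hinj _)).1 (h.trans h0.symm))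
    rw [lp.single_apply_ne _ _ _ hne, lp.single_apply_ne _ _ _ hj, map_zero]

end Induced

/-! ### Measurability of the induced cocycle -/

theorem separableSpace_lp {H : Type*} [NormedAddCommGroup H] [InnerProductSpace ℂ H]
    [TopologicalSpace.SeparableSpace H] :
    TopologicalSpace.SeparableSpace (lp (fun _ : ℕ => H) 2) := by
  have hsep : TopologicalSpace.IsSeparable
      (⋃ j : ℕ, range fun ξ : H => (lp.single 2 j ξ : lp (fun _ : ℕ => H) 2)) :=
    .iUnion fun j => TopologicalSpace.isSeparable_range
      (lp.isometry_single (E := fun _ : ℕ => H) j).continuous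
  have h := (hsep.span (R := ℂ)).closure
  rw [← TopologicalSpace.isSeparable_univ_iff]
  refine h.mono fun F _ => mem_closure_of_tendsto (lp.hasSum_single (by norm_num) F)
    (Eventually.of_forall fun s => Submodule.sum_mem _ fun j _ => Submodule.subset_span ?_)
  exact mem_iUnion.2 ⟨j, F j, rfl⟩

theorem measurable_sInf_nat {W : Type*} [MeasurableSpace W] {P : W → ℕ → Prop}
    (hP : ∀ n, MeasurableSet {w | P w n}) : Measurable fun w => sInf {n | P w n} := by
  refine measurable_of_Iic fun m => ?_
  have : (fun w => sInf {n | P w n}) ⁻¹' Iic m =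
      -- The second set is needed because `sInf ∅ = 0` lies below every `m`.
      (⋃ n ∈ Iic m, {w | P w n}) ∪ ⋂ n, {w | P w n}ᶜ := by
    ext w
    simp only [mem_preimage, mem_Iic, mem_union, mem_iUnion, mem_iInter, mem_compl_iff,
      mem_ofPred_eq, exists_prop]
    constructor
    · intro h
      by_cases hne : {n | P w n}.Nonempty
      · exact Or.inl ⟨_, h, Nat.sInf_mem hne⟩
      · exact Or.inr fun n hn => hne ⟨n, hn⟩
    · rintro (⟨n, hn, hPn⟩ | h)
      · exact (Nat.sInf_le hPn).trans hn
      · have : {n | P w n} = ∅ := eq_empty_of_forall_notMem h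
        simp [this]
  rw [this]
  exact (MeasurableSet.biUnion (to_countable _) fun n _ => hP n).union
    (MeasurableSet.iInter fun n => (hP n).compl)

section Measurability

variable {Γ : Type u} [Group Γ] {X : Type z} [MulAction Γ X] [MeasurableSpace X]
  [StandardBorelSpace X] {W : Type*} [MeasurableSpace W]

theorem measurable_orbitCode (hΓ : ∀ g : Γ, Measurable fun x : X => g • x) (e : ℕ → Γ)
    {a b : W → X} (ha : Measurable a) (hb : Measurable b) :
    Measurable fun w => orbitCode e (a w) (b w) :=
  measurable_sInf_nat fun n => measurableSet_eq_fun ((hΓ (e n)).comp ha) hb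

variable [Countable Γ]

theorem measurableSet_exists_smul_eq (hΓ : ∀ g : Γ, Measurable fun x : X => g • x) {a b : W → X}
    (ha : Measurable a) (hb : Measurable b) : MeasurableSet {w | ∃ g : Γ, g • a w = b w} := by
  have : {w | ∃ g : Γ, g • a w = b w} = ⋃ g : Γ, {w | g • a w = b w} := by
    ext
    simp
  rw [this]
  exact MeasurableSet.iUnion fun g => measurableSet_eq_fun ((hΓ g).comp ha) hb

variable {f : ℕ → X → X}

theorem measurableSet_orbitSeq_eq (hΓ : ∀ g : Γ, Measurable fun x : X => g • x)
    (hf : ∀ n, Measurable (f n)) {a b : W → X} (ha : Measurable a) (hb : Measurable b) (k l : ℕ) :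
    MeasurableSet {w | orbitSeq Γ f (a w) k = orbitSeq Γ f (b w) l} := by
  simp only [orbitSeq, mk_eq_mk_iff_exists_smul]
  exact measurableSet_exists_smul_eq hΓ ((hf _).comp ha) ((hf _).comp hb)

theorem measurable_orbitLabel_snd (hΓ : ∀ g : Γ, Measurable fun x : X => g • x)
    (hf : ∀ n, Measurable (f n)) (k : ℕ) :
    Measurable fun x => (orbitLabel Γ f x k).2 := by
  classical
  have : ∀ m, Measurable fun x => Nat.count (fun l => orbitSeq Γ f x l = orbitSeq Γ f x k) m := by
    intro m
    induction m with
    | zero => simp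
    | succ m ih =>
      simp only [Nat.count_succ]
      exact ih.add (Measurable.ite
        (measurableSet_orbitSeq_eq hΓ hf measurable_id measurable_id m k) measurable_const
        measurable_const)
  convert this k using 2
  simp only [orbitLabel, rankedLabel]
  congr!

/-- No Borel structure on the orbit space is needed: labels enter only through equality of orbits, a
countable union over `Γ`, and through their ranks. -/
theorem measurable_matching_orbitLabel (hΓ : ∀ g : Γ, Measurable fun x : X => g • x)
    (hf : ∀ n, Measurable (f n)) {a b : W → X} (ha : Measurable a) (hb : Measurable b) (k : ℕ) :
    Measurable fun w => matching (orbitLabel Γ f (a w)) (orbitLabel Γ f (b w)) k := by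
  refine measurable_sInf_nat fun l => ?_
  have : {w | orbitLabel Γ f (b w) l = orbitLabel Γ f (a w) k} =
      {w | orbitSeq Γ f (b w) l = orbitSeq Γ f (a w) k} ∩
        {w | (orbitLabel Γ f (b w) l).2 = (orbitLabel Γ f (a w) k).2} := by
    ext w
    exact Prod.ext_iff
  rw [this]
  exact (measurableSet_orbitSeq_eq hΓ hf hb ha l k).inter (measurableSet_eq_fun
    ((measurable_orbitLabel_snd hΓ hf l).comp hb) ((measurable_orbitLabel_snd hΓ hf k).comp ha))

theorem measurableSet_bijective_nat {σ : W → ℕ → ℕ} (hσ : ∀ k, Measurable fun w => σ w k) :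
    MeasurableSet {w | Function.Bijective (σ w)} := by
  have : {w | Function.Bijective (σ w)} =
      (⋂ k, ⋂ l, {w | σ w k = σ w l → k = l}) ∩ ⋂ l, ⋃ k, {w | σ w k = l} := by
    ext w
    simp [Function.Bijective, Function.Injective, Function.Surjective]
  rw [this]
  refine (MeasurableSet.iInter fun k => MeasurableSet.iInter fun l => ?_).inter
    (MeasurableSet.iInter fun l => MeasurableSet.iUnion fun k =>
      measurableSet_eq_fun (hσ k) measurable_const)
  by_cases hkl : k = l
  · simp [hkl]
  · simp only [hkl, imp_false]
    exact (measurableSet_eq_fun (hσ k) (hσ l)).compl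

variable {H : Type v} [NormedAddCommGroup H] [InnerProductSpace ℂ H] [CompleteSpace H]

/-- Where the matching is bijective, each coordinate depends on the pair of points only through two
measurable natural numbers, an index and a code for a group element; elsewhere the operator is the
identity. Summing the coordinates gives a pointwise limit of strongly measurable maps. -/
theorem stronglyMeasurable_inducedCocycle (hΓ : ∀ g : Γ, Measurable fun x : X => g • x)
    (hf : ∀ n, Measurable (f n)) (e : ℕ → Γ) (π : Γ → H ≃ₗᵢ[ℂ] H) (F : lp (fun _ : ℕ => H) 2) :
    StronglyMeasurable fun p : X × X => inducedCocycle e f π p.1 p.2 F := by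
  classical
  let σ : X × X → ℕ → ℕ := fun p => matching (orbitLabel Γ f p.2) (orbitLabel Γ f p.1)
  have hσ : ∀ j, Measurable fun p => σ p j := fun j =>
    measurable_matching_orbitLabel hΓ hf measurable_snd measurable_fst j
  let c : X × X → ℕ → ℕ := fun p j => orbitCode e (f (σ p j).unpair.1 p.1) (f j.unpair.1 p.2)
  have hc : ∀ j, Measurable fun p => c p j := by
    intro j
    refine measurable_orbitCode hΓ e ?_ ((hf _).comp measurable_snd)
    have h1 : Measurable fun q : ℕ × X => f q.1.unpair.1 q.2 :=
      measurable_from_prod_countable_right fun n => hf n.unpair.1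
    exact h1.comp ((hσ j).prodMk measurable_fst)
  have hbij : MeasurableSet {p | Function.Bijective (σ p)} := measurableSet_bijective_nat hσ
  have hterm : ∀ j, StronglyMeasurable fun p =>
      if Function.Bijective (σ p) then
        (lp.single 2 j (π (e (c p j)) (F (σ p j))) : lp (fun _ : ℕ => H) 2)
      else lp.single 2 j (F j) := by
    intro j
    refine StronglyMeasurable.ite hbij ?_ stronglyMeasurable_const
    have h2 : StronglyMeasurable fun q : ℕ × ℕ =>
        (lp.single 2 j (π (e q.1) (F q.2)) : lp (fun _ : ℕ => H) 2) := .of_discrete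
    exact h2.comp_measurable ((hc j).prodMk (hσ j))
  refine stronglyMeasurable_of_tendsto atTop
    (fun n => Finset.stronglyMeasurable_fun_sum (Finset.range n) fun j _ => hterm j)
    (tendsto_pi_nhds.2 fun p => ?_)
  refine HasSum.tendsto_sum_nat ?_
  convert lp.hasSum_single (p := 2) (by norm_num) (inducedCocycle e f π p.1 p.2 F) using 2 with j
  by_cases hp : Function.Bijective (σ p)
  · rw [if_pos hp, inducedCocycle_apply_of_bijective hp]
  · rw [if_neg hp, inducedCocycle, dif_neg hp]
    rfl

end Measurability

/-! ### Representations on square integrable functions -/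

/-- An isometry at distance less than one from a unitary is surjective. -/
theorem surjective_of_norm_sub_le {L : Type*} [NormedAddCommGroup L] [InnerProductSpace ℂ L]
    [CompleteSpace L] (A : L →ₗᵢ[ℂ] L) (U : L ≃ₗᵢ[ℂ] L) {ε : ℝ} (hε0 : 0 ≤ ε) (hε : ε < 1)
    (h : ∀ v, ‖A v - U v‖ ≤ ε * ‖v‖) : Function.Surjective A := by
  let B : L →L[ℂ] L :=
    ((U.symm.toContinuousLinearEquiv : L →L[ℂ] L)).comp A.toContinuousLinearMap
  have hB : ‖1 - B‖ ≤ ε := by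
    refine ContinuousLinearMap.opNorm_le_bound _ hε0 fun v => ?_
    have : (1 - B) v = U.symm (U v - A v) := by simp [B]
    rw [this, U.symm.norm_map, norm_sub_rev]
    exact h v
  have hunit : IsUnit B := by
    have := isUnit_one_sub_of_norm_lt_one (hB.trans_lt hε)
    rwa [sub_sub_cancel] at this
  obtain ⟨C, hC⟩ := hunit
  intro v
  refine ⟨(↑C⁻¹ : L →L[ℂ] L) (U.symm v), ?_⟩
  have h0 : B * ↑C⁻¹ = 1 := by rw [← hC, C.mul_inv]
  have h1 : B ((↑C⁻¹ : L →L[ℂ] L) (U.symm v)) = U.symm v := DFunLike.congr_fun h0 _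
  exact U.symm.injective h1

section Twisted

variable {X : Type z} [MeasurableSpace X] {μ : Measure X}
  {K : Type w} [NormedAddCommGroup K] [InnerProductSpace ℂ K] [TopologicalSpace.SeparableSpace K]

/-- A function measurable in `x` and continuous in the vector is jointly measurable, as `K` is
separable. -/
theorem stronglyMeasurable_unitary_apply {c : X → K ≃ₗᵢ[ℂ] K}
    (hc : ∀ ξ, StronglyMeasurable fun x => c x ξ) {f : X → K} (hf : StronglyMeasurable f) :
    StronglyMeasurable fun x => c x (f x) := by
  borelize K
  have : SecondCountableTopology K := UniformSpace.secondCountable_of_separable K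
  have h := stronglyMeasurable_uncurry_of_continuous_of_stronglyMeasurable
    (u := fun (ξ : K) x => c x ξ) (fun x => (c x).continuous) hc
  exact h.comp_measurable (hf.measurable.prodMk measurable_id)

theorem memLp_unitary_apply {c : X → K ≃ₗᵢ[ℂ] K} (hc : ∀ ξ, StronglyMeasurable fun x => c x ξ)
    (f : Lp K 2 μ) : MemLp (fun x => c x (f x)) 2 μ :=
  (Lp.memLp f).of_le
    (stronglyMeasurable_unitary_apply hc (Lp.stronglyMeasurable f)).aestronglyMeasurable
    (ae_of_all _ fun x => ((c x).norm_map _).le)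

/-- Multiplication with a measurable family of unitaries. -/
noncomputable def lpMultiplication (c : X → K ≃ₗᵢ[ℂ] K)
    (hc : ∀ ξ, StronglyMeasurable fun x => c x ξ) : Lp K 2 μ →ₗᵢ[ℂ] Lp K 2 μ where
  toFun f := (memLp_unitary_apply hc f).toLp _
  map_add' f g := by
    refine Lp.ext ?_
    filter_upwards [(memLp_unitary_apply hc (f + g)).coeFn_toLp,
      (memLp_unitary_apply hc f).coeFn_toLp, (memLp_unitary_apply hc g).coeFn_toLp,
      Lp.coeFn_add f g,
      Lp.coeFn_add ((memLp_unitary_apply hc f).toLp _) ((memLp_unitary_apply hc g).toLp _)]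
      with x h1 h2 h3 h4 h5
    rw [h1, h5, Pi.add_apply, h2, h3, h4, Pi.add_apply, map_add]
  map_smul' a f := by
    refine Lp.ext ?_
    filter_upwards [(memLp_unitary_apply hc (a • f)).coeFn_toLp,
      (memLp_unitary_apply hc f).coeFn_toLp,
      Lp.coeFn_smul a f, Lp.coeFn_smul a ((memLp_unitary_apply hc f).toLp _)] with x h1 h2 h3 h4
    rw [h1, RingHom.id_apply, h4, Pi.smul_apply, h2, h3, Pi.smul_apply, map_smul]
  norm_map' f := by
    change ‖(memLp_unitary_apply hc f).toLp _‖ = ‖f‖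
    rw [Lp.norm_toLp, Lp.norm_def]
    congr 1
    exact eLpNorm_congr_norm_ae (ae_of_all _ fun x => (c x).norm_map _)

/-- Composition with a measure preserving map and multiplication with a measurable family of
unitaries. -/
noncomputable def twistedComp (c : X → K ≃ₗᵢ[ℂ] K) (hc : ∀ ξ, StronglyMeasurable fun x => c x ξ)
    (T : X → X) (hT : MeasurePreserving T μ μ) : Lp K 2 μ →ₗᵢ[ℂ] Lp K 2 μ :=
  (lpMultiplication c hc).comp (Lp.compMeasurePreservingₗᵢ ℂ T hT)

theorem coeFn_twistedComp (c : X → K ≃ₗᵢ[ℂ] K) (hc : ∀ ξ, StronglyMeasurable fun x => c x ξ)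
    (T : X → X) (hT : MeasurePreserving T μ μ) (f : Lp K 2 μ) :
    twistedComp c hc T hT f =ᵐ[μ] fun x => c x (f (T x)) := by
  have h1 : twistedComp c hc T hT f =ᵐ[μ]
      fun x => c x (Lp.compMeasurePreserving T hT f x) := MemLp.coeFn_toLp
    (memLp_unitary_apply hc (Lp.compMeasurePreserving T hT f))
  filter_upwards [h1, Lp.coeFn_compMeasurePreserving f hT] with x hx1 hx2
  rw [hx1, hx2]
  rfl

theorem norm_twistedComp_sub_le {c c' : X → K ≃ₗᵢ[ℂ] K}
    (hc : ∀ ξ, StronglyMeasurable fun x => c x ξ) (hc' : ∀ ξ, StronglyMeasurable fun x => c' x ξ)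
    (T : X → X) (hT : MeasurePreserving T μ μ) {ε : ℝ}
    (h : ∀ᵐ x ∂μ, ∀ ξ, ‖c x ξ - c' x ξ‖ ≤ ε * ‖ξ‖) (f : Lp K 2 μ) :
    ‖twistedComp c hc T hT f - twistedComp c' hc' T hT f‖ ≤ ε * ‖f‖ := by
  rw [← Lp.norm_compMeasurePreserving f hT]
  refine Lp.norm_le_mul_norm_of_ae_le_mul ?_
  filter_upwards [h, coeFn_twistedComp c hc T hT f, coeFn_twistedComp c' hc' T hT f,
    Lp.coeFn_sub (twistedComp c hc T hT f) (twistedComp c' hc' T hT f),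
    Lp.coeFn_compMeasurePreserving f hT] with x h1 h2 h3 h4 h5
  rw [h4, Pi.sub_apply, h2, h3, h5]
  exact h1 _

variable {Γ : Type u} [Group Γ] [MulAction Γ X]
  {H : Type v} [NormedAddCommGroup H] [InnerProductSpace ℂ H]

/-- A quasirepresentation of an equivalence relation near to a representation gives a nearby
extension of every map into the unitaries which it extends along the orbits. -/
theorem hasNearbyExtension_of_cocycle [CompleteSpace K] [StandardBorelSpace X]
    [IsProbabilityMeasure μ]
    (hΓ : ∀ g : Γ, MeasurePreserving (fun x : X => g • x) μ μ)
    {η η₁ : X → X → K ≃ₗᵢ[ℂ] K}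
    (hη : ∀ ξ, StronglyMeasurable fun p : X × X => η p.1 p.2 ξ)
    (hη₁ : ∀ ξ, StronglyMeasurable fun p : X × X => η₁ p.1 p.2 ξ)
    (hself : ∀ᵐ x ∂μ, η x x = 1)
    (hmul : ∀ᵐ x ∂μ, ∀ (a b c : Γ) (ξ : K),
      η₁ (b • x) (c • x) (η₁ (a • x) (b • x) ξ) = η₁ (a • x) (c • x) ξ)
    {ε : ℝ} (hε0 : 0 ≤ ε) (hε : ε < 1)
    (hdist : ∀ᵐ x ∂μ, ∀ (a : Γ) (ξ : K), ‖η (a • x) x ξ - η₁ (a • x) x ξ‖ ≤ ε * ‖ξ‖)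
    {π : Γ → H ≃ₗᵢ[ℂ] H} (j : H →ₗᵢ[ℂ] K)
    (hj : ∀ᵐ x ∂μ, ∀ (g : Γ) (ξ : H), η (g⁻¹ • x) x (j ξ) = j (π g ξ)) :
    HasNearbyExtension.{u, v, v'} ε π := by
  have hc : ∀ {ζ : X → X → K ≃ₗᵢ[ℂ] K},
      (∀ ξ, StronglyMeasurable fun p : X × X => ζ p.1 p.2 ξ) → ∀ (g : Γ) (ξ : K),
      StronglyMeasurable fun x => ζ (g⁻¹ • x) x ξ := fun hζ g ξ =>
    (hζ ξ).comp_measurable ((hΓ g⁻¹).measurable.prodMk measurable_id)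
  let A : Γ → Lp K 2 μ →ₗᵢ[ℂ] Lp K 2 μ := fun g => twistedComp _ (hc hη g) _ (hΓ g⁻¹)
  let A₁ : Γ → Lp K 2 μ →ₗᵢ[ℂ] Lp K 2 μ := fun g => twistedComp _ (hc hη₁ g) _ (hΓ g⁻¹)
  have hA : ∀ g f, A g f =ᵐ[μ] fun x => η (g⁻¹ • x) x (f (g⁻¹ • x)) := fun g f =>
    coeFn_twistedComp _ _ _ _ f
  have hA₁ : ∀ g f, A₁ g f =ᵐ[μ] fun x => η₁ (g⁻¹ • x) x (f (g⁻¹ • x)) := fun g f =>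
    coeFn_twistedComp _ _ _ _ f
  have hA₁mul : ∀ g h f, A₁ (g * h) f = A₁ g (A₁ h f) := by
    intro g h f
    refine Lp.ext ?_
    filter_upwards [hA₁ (g * h) f, hA₁ g (A₁ h f),
      (hΓ g⁻¹).quasiMeasurePreserving.ae (hA₁ h f), hmul] with x h1 h2 h3 h4
    rw [h1, h2, h3, mul_inv_rev, mul_smul]
    -- The path from `h⁻¹g⁻¹x` through `g⁻¹x` to `x`.
    have := h4 (h⁻¹ * g⁻¹) g⁻¹ 1 (f (h⁻¹ • g⁻¹ • x))
    simp only [one_smul, mul_smul] at this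
    exact this.symm
  have hA₁one : ∀ f, A₁ 1 f = f := by
    intro f
    refine Lp.ext ?_
    filter_upwards [hA₁ 1 f, hmul] with x h1 h2
    rw [h1, inv_one, one_smul]
    -- Multiplicativity makes `η₁ x x` idempotent, and an injective idempotent is the identity.
    have := h2 1 1 1 (f x)
    rw [one_smul] at this
    exact (η₁ x x).injective this
  have hA₁surj : ∀ g, Function.Surjective (A₁ g) := fun g f =>
    ⟨A₁ g⁻¹ f, by rw [← hA₁mul, mul_inv_cancel, hA₁one]⟩
  let π₁ : Γ → Lp K 2 μ ≃ₗᵢ[ℂ] Lp K 2 μ := fun g =>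
    LinearIsometryEquiv.ofSurjective (A₁ g) (hA₁surj g)
  have hclose : ∀ g f, ‖A g f - π₁ g f‖ ≤ ε * ‖f‖ := fun g f =>
    norm_twistedComp_sub_le (hc hη g) (hc hη₁ g) _ _ (hdist.mono fun x hx => hx g⁻¹) f
  -- The operators `A g` are not multiplicative, so `A g⁻¹` need not invert `A g`; surjectivity
  -- comes from being within `ε < 1` of a unitary.
  let π' : Γ → Lp K 2 μ ≃ₗᵢ[ℂ] Lp K 2 μ := fun g =>
    LinearIsometryEquiv.ofSurjective (A g)
      (surjective_of_norm_sub_le (A g) (π₁ g) hε0 hε (hclose g))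
  let V : H →ₗᵢ[ℂ] Lp K 2 μ :=
    ⟨(Lp.constₗ 2 μ ℂ).comp j.toLinearMap, fun ξ => by
      -- Constants embed isometrically because `μ` has total mass one.
      refine (Lp.norm_const' 2 μ (j ξ) (by norm_num) (by norm_num)).trans ?_
      simp⟩
  have hV : ∀ ξ, V ξ =ᵐ[μ] fun _ => j ξ := fun ξ => Lp.coeFn_const 2 μ (j ξ)
  have : Fact ((2 : ℝ≥0∞) ≠ ∞) := ⟨by norm_num⟩
  have : SecondCountableTopology (Lp K 2 μ) := inferInstance
  refine HasNearbyExtension.of_separable V π' π₁ ?_ ?_ ?_ hclose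
  · ext1 f
    refine Lp.ext ?_
    filter_upwards [hA 1 f, hself] with x h1 h2
    change A 1 f x = f x
    rw [h1, inv_one, one_smul, h2]
    rfl
  · intro g ξ
    refine Lp.ext ?_
    filter_upwards [hA g (V ξ), (hΓ g⁻¹).quasiMeasurePreserving.ae (hV ξ), hV (π g ξ), hj]
      with x h1 h2 h3 h4
    change A g (V ξ) x = _
    rw [h1, h2, h3, h4]
  · intro g h
    ext1 f
    exact hA₁mul g h f

end Twisted

/-! ### From equivalence relations to groups -/

section Main

theorem enorm_le_ofReal_of_forall_le {L : Type*} [NormedAddCommGroup L] [InnerProductSpace ℂ L]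
    {A : L →L[ℂ] L} {δ : ℝ} (hδ : 0 ≤ δ) (h : ∀ v, ‖A v‖ ≤ δ * ‖v‖) :
    ‖A‖ₑ ≤ ENNReal.ofReal δ := by
  rw [← ofReal_norm]
  exact ENNReal.ofReal_le_ofReal (A.opNorm_le_bound hδ h)

theorem norm_apply_le_of_enorm_lt {L : Type*} [NormedAddCommGroup L] [InnerProductSpace ℂ L]
    {A : L →L[ℂ] L} {ε : ℝ} (h : ‖A‖ₑ < ENNReal.ofReal ε) (v : L) : ‖A v‖ ≤ ε * ‖v‖ := by
  have hε : 0 < ε := ENNReal.ofReal_pos.1 (pos_of_gt h)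
  rw [← ofReal_norm, ENNReal.ofReal_lt_ofReal_iff hε] at h
  exact A.le_of_opNorm_le h.le v

variable {X : Type z} {K : Type w} [NormedAddCommGroup K] [InnerProductSpace ℂ K] [CompleteSpace K]

open Classical in
/-- A family of unitaries on an equivalence relation, extended by the identity. -/
noncomputable def extendRel (E : Setoid X) (η : X → X → unitary (K →L[ℂ] K)) (x y : X) :
    K ≃ₗᵢ[ℂ] K :=
  if E x y then Unitary.linearIsometryEquiv (η x y) else 1

theorem extendRel_apply {E : Setoid X} (η : X → X → unitary (K →L[ℂ] K)) {x y : X} (h : E x y)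
    (ξ : K) : extendRel E η x y ξ = (η x y : K →L[ℂ] K) ξ := by
  rw [extendRel, if_pos h]
  rfl

variable [MeasurableSpace X]

theorem stronglyMeasurable_extendRel {E : Setoid X} (hE : MeasurableSet {p : X × X | E p.1 p.2})
    {η : X → X → unitary (K →L[ℂ] K)} (ξ : K)
    (hη : StronglyMeasurable
      fun p : {p : X × X // E p.1 p.2} => (η p.1.1 p.1.2 : K →L[ℂ] K) ξ) :
    StronglyMeasurable fun p : X × X => extendRel E η p.1 p.2 ξ := by
  have hemb : MeasurableEmbedding (Subtype.val : {p : X × X // E p.1 p.2} → X × X) :=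
    MeasurableEmbedding.subtype_coe hE
  convert hemb.stronglyMeasurable_extend hη (stronglyMeasurable_const (b := ξ)) with p
  by_cases hp : E p.1 p.2
  · rw [extendRel_apply η hp]
    exact (hemb.injective.extend_apply (fun p : {p : X × X // E p.1 p.2} =>
      (η p.1.1 p.1.2 : K →L[ℂ] K) ξ) (fun _ => ξ) ⟨p, hp⟩).symm
  · rw [extendRel, if_neg hp, Function.extend_apply' _ _ _ (by simpa using hp)]
    rfl

variable [StandardBorelSpace X] {μ : Measure X} [IsProbabilityMeasure μ] {E : Setoid X}
  {Γ : Type u} [Group Γ]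

/-- A representation of the equivalence relation near to a quasirepresentation gives nearby
extensions of the maps into the unitaries which the latter extends along the orbits. -/
theorem hasNearbyExtension_of_relDist_lt [TopologicalSpace.SeparableSpace K] [MulAction Γ X]
    (hE : IsCountableMPEquivRel μ E) (hmp : ∀ g : Γ, MeasurePreserving (fun x : X => g • x) μ μ)
    (horb : ∀ᵐ x ∂μ, ∀ g : Γ, E x (g • x)) {η η₁ : X → X → unitary (K →L[ℂ] K)}
    (hη : IsUnitaryQuasiRep μ E η) (hη₁ : IsUnitaryRep μ E η₁) {ε : ℝ} (hε0 : 0 < ε)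
    (hε1 : ε < 1) (hdist : relDist μ E η₁ η < ENNReal.ofReal ε)
    {H : Type v} [NormedAddCommGroup H] [InnerProductSpace ℂ H] {π : Γ → H ≃ₗᵢ[ℂ] H}
    (j : H →ₗᵢ[ℂ] K)
    (hj : ∀ᵐ x ∂μ, ∀ (g : Γ) (ξ : H), (η (g⁻¹ • x) x : K →L[ℂ] K) (j ξ) = j (π g ξ)) :
    HasNearbyExtension.{u, v, v'} ε π := by
  have hmul : ∀ᵐ x ∂μ, ∀ q ∈ {q : X × X | E x q.1 ∧ E q.1 q.2},
      η₁ q.1 q.2 * η₁ x q.1 = η₁ x q.2 := (ae_fiberMeasure_iff _ _ _).1 hη₁.map_mul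
  have hclose : ∀ᵐ x ∂μ, ∀ y ∈ {y | E x y},
      ‖(η₁ x y : K →L[ℂ] K) - η x y‖ₑ < ENNReal.ofReal ε :=
    (ae_fiberMeasure_iff _ _ _).1 (eventually_lt_of_limsup_lt hdist)
  refine hasNearbyExtension_of_cocycle (η := extendRel E η) (η₁ := extendRel E η₁) hmp
    (fun F => stronglyMeasurable_extendRel hE.measurableSet F (hη.stronglyMeasurable F))
    (fun F => stronglyMeasurable_extendRel hE.measurableSet F (hη₁.stronglyMeasurable F))
    ?_ ?_ hε0.le hε1 ?_ j ?_
  · filter_upwards [hη.map_self] with x hx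
    ext1 F
    rw [extendRel_apply η (E.refl x), hx]
    rfl
  -- The identity is needed at the base point `a • x` for all `a` at once, hence on the whole class
  -- of `x`.
  · filter_upwards [horb, hE.ae_forall_class hmul] with x hr hxm a b c F
    have hab : E (a • x) (b • x) := E.trans (E.symm (hr a)) (hr b)
    have hbc : E (b • x) (c • x) := E.trans (E.symm (hr b)) (hr c)
    rw [extendRel_apply η₁ hab, extendRel_apply η₁ hbc, extendRel_apply η₁ (E.trans hab hbc),
      ← hxm (a • x) (hr a) (b • x, c • x) ⟨hab, hbc⟩]
    rfl
  · filter_upwards [horb, hE.ae_forall_class hclose] with x hr hxc a F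
    have hax : E (a • x) x := E.symm (hr a)
    rw [extendRel_apply η hax, extendRel_apply η₁ hax, norm_sub_rev]
    exact norm_apply_le_of_enorm_lt (hxc (a • x) (hr a) x hax) F
  · filter_upwards [horb, hj] with x hr hxj g ξ
    rw [extendRel_apply η (E.symm (hr g⁻¹)), hxj]

variable [Countable Γ]

/-- An almost representation of a group acting inside the classes of an equivalence relation
extends along the orbits to an almost representation of the relation. -/
theorem exists_induced_almostRep (hE : IsCountableMPEquivRel μ E) [MulAction Γ X]
    (hmp : ∀ g : Γ, MeasurePreserving (fun x : X => g • x) μ μ)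
    (hfree : ∀ᵐ x ∂μ, ∀ g : Γ, g • x = x → g = 1) (horb : ∀ᵐ x ∂μ, ∀ g : Γ, E x (g • x))
    {H : Type w} [NormedAddCommGroup H] [InnerProductSpace ℂ H] [CompleteSpace H]
    {π : Γ → H ≃ₗᵢ[ℂ] H} (h1 : π 1 = 1) {δ : ℝ} (hδ0 : 0 ≤ δ)
    (hπ : ∀ g h ξ, ‖π g (π h ξ) - π (g * h) ξ‖ ≤ δ * ‖ξ‖) :
    ∃ η : X → X → unitary (lp (fun _ : ℕ => H) 2 →L[ℂ] lp (fun _ : ℕ => H) 2),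
      IsUnitaryQuasiRep μ E η ∧ defect μ E η ≤ ENNReal.ofReal δ ∧
      ∀ᵐ x ∂μ, ∀ (g : Γ) (ξ : H),
        (η (g⁻¹ • x) x : lp (fun _ : ℕ => H) 2 →L[ℂ] lp (fun _ : ℕ => H) 2) (lp.single 2 0 ξ) =
          lp.single 2 0 (π g ξ) := by
  obtain ⟨f, hf, hfE, hf0, hcov⟩ :=
    exists_measurable_sections μ hE.measurableSet hE.countable_class
  obtain ⟨e, he⟩ := exists_surjective_nat Γ
  have hreg : ∀ᵐ x ∂μ, IsRegularPoint Γ E f x := hE.ae_forall_class <| by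
    filter_upwards [hfree, horb, hcov] with x h1 h2 h3 using ⟨h1, h2, h3⟩
  refine ⟨fun x y => Unitary.linearIsometryEquiv.symm (inducedCocycle e f π x y),
    ⟨fun F => ?_, ?_⟩, ?_, ?_⟩
  · exact (stronglyMeasurable_inducedCocycle (fun g => (hmp g).measurable) hf e π F).comp_measurable
      measurable_subtype_coe
  · filter_upwards [hreg] with x hx
    rw [inducedCocycle_self he hfE h1 hx, map_one]
  · refine limsup_le_of_le (by isBoundedDefault) ?_
    refine (ae_fiberMeasure_iff _ _ _).2 ?_
    filter_upwards [hreg] with x hx q hq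
    refine enorm_le_ofReal_of_forall_le hδ0 fun F => ?_
    exact norm_inducedCocycle_mul_sub_le he hfE hδ0 hπ hx hq.1 hq.2 F
  · filter_upwards [hreg] with x hx g ξ
    -- Take `g⁻¹ • x` as base point, so that `g` moves it to `x`.
    have h := inducedCocycle_single_zero (π := π) he hfE hf0
      (hx.of_rel ((hx x (E.refl x)).2.1 g⁻¹)) g ξ
    rw [smul_inv_smul] at h
    exact h

/-- The embedding of a coordinate into a Hilbert sum. -/
noncomputable def lpSingleIsometry (H : Type w) [NormedAddCommGroup H] [InnerProductSpace ℂ H]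
    (k : ℕ) : H →ₗᵢ[ℂ] lp (fun _ : ℕ => H) 2 where
  toFun ξ := lp.single 2 k ξ
  map_add' ξ ζ := lp.single_add (E := fun _ : ℕ => H) 2 k ξ ζ
  map_smul' c ξ := lp.single_smul (E := fun _ : ℕ => H) 2 k c ξ
  norm_map' ξ := by
    have h2 : (0 : ℝ≥0∞) < 2 := by norm_num
    exact lp.norm_single (E := fun _ : ℕ => H) (p := 2) h2 k ξ

/-- Almost representations of a group contained in a strongly Ulam stable equivalence relation
have nearby extensions, if their space is separable. -/
theorem exists_hasNearbyExtension (hE : IsCountableMPEquivRel μ E)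
    (hΓ : OrbitallyContains μ E Γ) (hstab : StronglyUlamStable.{z, w} μ E)
    {ε : ℝ} (hε0 : 0 < ε) (hε1 : ε < 1) :
    ∃ δ : ℝ, 0 < δ ∧ ∀ (H : Type w) [NormedAddCommGroup H] [InnerProductSpace ℂ H]
      [CompleteSpace H] [TopologicalSpace.SeparableSpace H] (π : Γ → H ≃ₗᵢ[ℂ] H), π 1 = 1 →
      (∀ g h ξ, ‖π g (π h ξ) - π (g * h) ξ‖ ≤ δ * ‖ξ‖) → HasNearbyExtension.{u, w, v} ε π := by
  obtain ⟨δ, hδ0, hδ⟩ := hstab ε hε0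
  refine ⟨δ, hδ0, fun H _ _ _ _ π h1 hπ => ?_⟩
  obtain ⟨act, hmp, hfree, horb⟩ := hΓ
  have := separableSpace_lp (H := H)
  obtain ⟨η, hη, hdefect, hj⟩ := exists_induced_almostRep hE hmp hfree horb h1 hδ0.le hπ
  obtain ⟨η₁, hη₁, hdist⟩ := hδ (lp (fun _ : ℕ => H) 2) η hη hdefect
  exact hasNearbyExtension_of_relDist_lt hE hmp horb hη hη₁ hε0 hε1 hdist
    (lpSingleIsometry H 0) hj

/-- A group contained in a strongly Ulam stable equivalence relation is extensionally strongly
Ulam stable. -/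
theorem extensionallyStronglyUlamStable_of_orbitallyContains (hE : IsCountableMPEquivRel μ E)
    (hΓ : OrbitallyContains μ E Γ) (hstab : StronglyUlamStable.{z, w} μ E) :
    ExtensionallyStronglyUlamStable.{u, v} Γ := by
  intro ε hε
  -- The bound 1/2 secures surjectivity of the extended operators; ε/2 turns the non-strict estimate
  -- on the supremum into a strict one.
  have hε' : 0 < min (ε / 2) (1 / 2) := lt_min (half_pos hε) (by norm_num)
  obtain ⟨δ, hδ0, hδ⟩ := exists_hasNearbyExtension.{u, v, w, z} hE hΓ hstab hε'
    ((min_le_right _ _).trans_lt (by norm_num))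
  refine ⟨δ, hδ0, fun H _ _ _ ρ hρ => ?_⟩
  have hsep : HasNearbyExtension.{u, v, v} (min (ε / 2) (1 / 2))
      fun g => Unitary.linearIsometryEquiv (ρ g) := by
    refine hasNearbyExtension_of_forall_separable (δ := δ) hε'.le ?_ _ ?_ ?_
    · intro K _ _ _ _ π h1 hπ
      -- Stability of `E` concerns spaces in universe `w`, so the separable space is first copied
      -- there.
      obtain ⟨L, _, _, _, _, ⟨Φ⟩⟩ := exists_linearIsometryEquiv_separable.{v, w} (H := K)
      refine HasNearbyExtension.of_equiv Φ (hδ L _ ?_ ?_)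
      · ext ξ
        simp [h1]
      · intro g h ξ
        simpa [← map_sub] using hπ g h (Φ.symm ξ)
    · rw [hρ.1, map_one]
    · intro g h ξ
      exact ContinuousLinearMap.le_of_opNorm_le _ (hρ.2 g h).le ξ
  obtain ⟨H', _, _, _, V, π', π₁, h1, hV, hmul, hclose⟩ := hsep
  refine ⟨H', inferInstance, inferInstance, inferInstance, V,
    fun g => Unitary.linearIsometryEquiv.symm (π' g),
    MonoidHom.mk' (fun g => Unitary.linearIsometryEquiv.symm (π₁ g)) fun g h => by
      rw [hmul, map_mul], ?_, hV, ?_⟩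
  · simp only [h1, map_one]
  · refine lt_of_le_of_lt (iSup_le fun g => enorm_le_ofReal_of_forall_le hε'.le (hclose g)) ?_
    rw [ENNReal.ofReal_lt_ofReal_iff hε]
    exact (min_le_left _ _).trans_lt (half_lt_self hε)

end Main

end UlamStability

theorem mainTheorem6 {H : Type u} [Group H] [Countable H]
    (hH : ¬ UlamStability.ExtensionallyStronglyUlamStable.{u, v} H)
    {X : Type z} [MeasurableSpace X] [StandardBorelSpace X]
    (μ : Measure X) [IsProbabilityMeasure μ]
    (E : Setoid X) (hE : UlamStability.IsCountableMPEquivRel μ E)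
    (hErg : UlamStability.IsErgodicRel μ E)
    (hCont : UlamStability.OrbitallyContains μ E H) :
    ¬ UlamStability.StronglyUlamStable.{z, w} μ E := fun hstab =>
  hH (UlamStability.extensionallyStronglyUlamStable_of_orbitallyContains hE hCont hstab)
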